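/- Let $K\ge 1$ be an integer and $\ell\ge 2$ an even integer, let $S_K=\{1,\dots,K,\omega\}$, and let $R\colon S_K^{\ell}\to\{1,\dots,\ell/2\}$ be a map (a $(K,\ell)$-rule). For a graph $G$ and a vertex $v$ let $c_K(v)$ be the number of vertices of the component of $v$ in $G$ if this number is at most $K$, and $\omega$ otherwise. The $R$-process on $n$ vertices starts with the graph $G_0$ with vertex set $\{1,\dots,n\}$ and no edges; in round $N\ge 1$ vertices $v_1,\dots,v_\ell$ are drawn independently and uniformly at random (independently of the previous rounds), and $G_N$ arises from $G_{N-1}$ by adding the edge $\{v_{2i-1},v_{2i}\}$, where $i=R(c_K(v_1),\dots,c_K(v_\ell))$ with component sizes taken in $G_{N-1}$; loops and multiple edges are ignored. Let $T_{\mathrm{con}}^{R}(n)\in\{0,1,2,\dots\}\cup\{\infty\}$ be the smallest $N$ such that $G_N$ is connected. For $1\le k\le K$ let $\mathrm{ext}_k(R)$ be $k$ times the number of vectors $s\in S_K^\ell$ that have exactly one entry equal to $k$ and all other entries equal to $\omega$, and that satisfy $\{s_{2i-1},s_{2i}\}=\{k,\omega\}$ for $i=R(s)$. The rule $R$ is called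 degenerate if $\min_{1\le k\le K}\mathrm{ext}_k(R)=0$. **Theorem.** For every degenerate $(K,\ell)$-rule $R$, $\mathbb{E}[T_{\mathrm{con}}^{R}(n)]=\Omega(n^2)$ as $n\to\infty$; that is, there are $c>0$ and $n_0$, depending only on $K$, $\ell$ and $R$, such that $\mathbb{E}[T_{\mathrm{con}}^{R}(n)]\ge c\,n^2$ for all $n\ge n_0$. -/

import Mathlib

open MeasureTheory
open scoped ENNReal

noncomputable section

namespace AchlioptasRule

/-- The set `S_K = {1, 2, …, K, ω}` of truncated component sizes. The top element `⊤` is `ω`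
(meaning "larger than `K`"). -/
abbrev SizeClass (K : ℕ) : Type := WithTop (Set.Icc 1 K)

/-- A `(K, ℓ)`-rule: a map `S_K ^ ℓ → [ℓ / 2]`. Positions and edge labels are counted from `0`. -/
abbrev Rule (K ℓ : ℕ) : Type := (Fin ℓ → SizeClass K) → Fin (ℓ / 2)

/-- The position of the first endpoint of the `i`-th offered edge (`2 i - 1` when counting
from `1`). -/
def fstPos {ℓ : ℕ} (i : Fin (ℓ / 2)) : Fin ℓ := ⟨2 * i.1, by have := i.2; omega⟩

/-- The position of the second endpoint of the `i`-th offered edge (`2 i` when counting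
from `1`). -/
def sndPos {ℓ : ℕ} (i : Fin (ℓ / 2)) : Fin ℓ := ⟨2 * i.1 + 1, by have := i.2; omega⟩

/-! ### Extinction rates -/

/-- `C_{μ,ν}(R)`: the size vectors for which the edge selected by `R` joins a `μ`-component and a
`ν`-component. -/
def joinVectors {K ℓ : ℕ} (R : Rule K ℓ) (μ ν : SizeClass K) : Set (Fin ℓ → SizeClass K) :=
  {s | ({s (fstPos (R s)), s (sndPos (R s))} : Set (SizeClass K)) = {μ, ν}}

/-- The extinction rate `ext_k(R)`: `k` times the number of vectors in `C_{k,ω}(R)` that have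
exactly one entry `k` and all other entries `ω`. -/
def ext {K ℓ : ℕ} (R : Rule K ℓ) (k : Set.Icc 1 K) : ℕ :=
  k.1 * {s : Fin ℓ → SizeClass K | s ∈ joinVectors R (k : SizeClass K) ⊤ ∧
    ∃ i : Fin ℓ, s i = (k : SizeClass K) ∧ ∀ j : Fin ℓ, j ≠ i → s j = ⊤}.ncard

/-- The total extinction rate `ext(R) = min_{1 ≤ k ≤ K} ext_k(R)` (used for `K ≥ 1` only). -/
def totalExt {K ℓ : ℕ} (R : Rule K ℓ) : ℕ := ⨅ k : Set.Icc 1 K, ext R k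

/-- A rule is degenerate if its total extinction rate vanishes. -/
def IsDegenerate {K ℓ : ℕ} (R : Rule K ℓ) : Prop := totalExt R = 0

/-! ### The random graph process -/

/-- The number of vertices in the component of `G` that contains `v`. -/
def compSize {V : Type*} (G : SimpleGraph V) (v : V) : ℕ :=
  (G.connectedComponentMk v).supp.ncard

theorem one_le_compSize {V : Type*} [Finite V] (G : SimpleGraph V) (v : V) :
    1 ≤ compSize G v :=
  (Set.ncard_pos (Set.toFinite _)).2 ⟨v, rfl⟩

/-- The truncated component size `c_K(G; v) ∈ S_K`. -/
def truncSize {V : Type*} [Finite V] (K : ℕ) (G : SimpleGraph V) (v : V) : SizeClass K :=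
  if h : compSize G v ≤ K then
    ((⟨compSize G v, one_le_compSize G v, h⟩ : Set.Icc 1 K) : SizeClass K)
  else ⊤

/-- One round: given the drawn vertices `v_1, …, v_ℓ`, add the edge that `R` selects. A loop
adds nothing, since `SimpleGraph.edge u u = ⊥`. -/
def step {K ℓ : ℕ} (R : Rule K ℓ) {V : Type*} [Finite V] (G : SimpleGraph V) (v : Fin ℓ → V) :
    SimpleGraph V :=
  G ⊔ SimpleGraph.edge (v (fstPos (R fun i => truncSize K G (v i))))
    (v (sndPos (R fun i => truncSize K G (v i))))

/-- The graph `G_N` after `N` rounds, as a function of the sequence `x` of draws (`x N` are the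
vertices drawn in the round that leads from `G_N` to `G_{N+1}`). -/
def graphProcess {K ℓ : ℕ} (R : Rule K ℓ) {V : Type*} [Finite V] (x : ℕ → Fin ℓ → V) :
    ℕ → SimpleGraph V
  | 0 => ⊥
  | N + 1 => step R (graphProcess R x N) (x N)

/-- The connection time: the smallest `N ∈ ℕ ∪ {∞}` such that `G_N` is connected. -/
def connTime {K ℓ : ℕ} (R : Rule K ℓ) {V : Type*} [Finite V] (x : ℕ → Fin ℓ → V) : ℕ∞ :=
  ⨅ (N : ℕ) (_ : (graphProcess R x N).Connected), (N : ℕ∞)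

/-- The law of the draws: in every round `ℓ` vertices of an `n`-element vertex set, all of them
independent and uniformly distributed. -/
def drawLaw (ℓ n : ℕ) [NeZero n] : Measure (ℕ → Fin ℓ → Fin n) :=
  Measure.infinitePi fun _ : ℕ =>
    Measure.pi fun _ : Fin ℓ => (PMF.uniformOfFintype (Fin n)).toMeasure

/-- The expected connection time `E[T_con^R(n)] ∈ [0, ∞]` of the `R`-process on `n` vertices. -/
def expectedConnTime {K ℓ : ℕ} (R : Rule K ℓ) (n : ℕ) [NeZero n] : ℝ≥0∞ :=
  ∫⁻ x, ((connTime R x : ℕ∞) : ℝ≥0∞) ∂(drawLaw ℓ n)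

end AchlioptasRule

end

noncomputable section

namespace AchlioptasRule

open Finset ProbabilityTheory
open scoped Classical BigOperators

/-! ### Component sizes after the insertion of an edge -/

section Graph

variable {V : Type*}

/-! Call a size `k ≤ K` persistent if its extinction rate is zero. If exactly one drawn vertex lies
in a small component (at most `K` vertices) and that component has persistent size, the rule cannot
join it to a large component. Persistent vertices are therefore lost only in rounds that draw two
small vertices. Once few small vertices are left, such rounds are so rare that persistent components
last for order `n ^ 2` rounds, and the graph stays disconnected.

Let `Y`, `W` and `X = Y + W` count the persistent, the decaying and all small vertices. The main
tool is `y = 1 / (Y + 1)`, which equals 1 exactly when `Y = 0`, so that its expectation bounds the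
probability of extinction. A round increases `y` on average by `O(y ^ 2 * X * Y / n ^ 2) = O((1 + r)
/ n ^ 2)`, where `r = W * y`. The ratio `r` is kept under control because a decaying vertex is
absorbed by a large component with probability of order `1 / n`, while new decaying vertices need
two small draws. For `X ≤ δ n` both effects combine in the potential `y + (A / n) * r`, whose drift
is `O(1 / n ^ 2)` (`exists_iterate_invCard_persistent_le`, `exists_survival`).

It remains to reach a state with `X ≤ δ n` and `Y` linear in `n`. During the first `n / 4` rounds
half of the vertices stay isolated, and an induction on the size produces linearly many vertices of
each size up to `K` in expectation (`exists_le_expected_card`); hence `Y` is linear with probability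
bounded below (`exists_le_prob_persistent`). Over the next `T n` rounds a bounded potential forces
`X ≤ δ n`, while the expectation of `y` grows only by a constant factor (`exists_decline`).

All estimates concern iterates of the averaging operator `transition`; `integral_graphProcess`
identifies these with expectations under the law of the draws. -/

theorem reachable_sup_edge_iff (G : SimpleGraph V) (u w a b : V) :
    (G ⊔ SimpleGraph.edge u w).Reachable a b ↔
      G.Reachable a b ∨ (G.Reachable a u ∧ G.Reachable w b) ∨
        (G.Reachable a w ∧ G.Reachable u b) := by
  constructor
  · rintro ⟨p⟩
    induction p with
    | nil => exact Or.inl .rfl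
    | cons h p ih =>
      rw [SimpleGraph.sup_adj, SimpleGraph.edge_adj] at h
      rcases h with h | ⟨⟨rfl, rfl⟩ | ⟨rfl, rfl⟩, -⟩
      · have := h.reachable
        rcases ih with ih | ⟨h1, h2⟩ | ⟨h1, h2⟩
        · exact Or.inl (this.trans ih)
        · exact Or.inr (Or.inl ⟨this.trans h1, h2⟩)
        · exact Or.inr (Or.inr ⟨this.trans h1, h2⟩)
      · rcases ih with ih | ⟨h1, h2⟩ | ⟨h1, h2⟩
        · exact Or.inr (Or.inl ⟨.rfl, ih⟩)
        · exact Or.inr (Or.inl ⟨.rfl, h2⟩)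
        · exact Or.inl h2
      · rcases ih with ih | ⟨h1, h2⟩ | ⟨h1, h2⟩
        · exact Or.inr (Or.inr ⟨.rfl, ih⟩)
        · exact Or.inl h2
        · exact Or.inr (Or.inr ⟨.rfl, h2⟩)
  · have hle : G ≤ G ⊔ SimpleGraph.edge u w := le_sup_left
    have huw : (G ⊔ SimpleGraph.edge u w).Reachable u w := by
      by_cases h : u = w
      · subst h; exact .rfl
      · exact SimpleGraph.Adj.reachable (by simp [SimpleGraph.edge_adj, h])
    rintro (h | ⟨h1, h2⟩ | ⟨h1, h2⟩)
    · exact h.mono hle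
    · exact (h1.mono hle).trans (huw.trans (h2.mono hle))
    · exact (h1.mono hle).trans (huw.symm.trans (h2.mono hle))

theorem compSize_eq_ncard (G : SimpleGraph V) (v : V) :
    compSize G v = {x | G.Reachable v x}.ncard := by
  unfold compSize
  congr 1
  ext x
  simp [SimpleGraph.ConnectedComponent.mem_supp_iff, SimpleGraph.reachable_comm]

theorem compSize_congr {G : SimpleGraph V} {v w : V} (h : G.Reachable v w) :
    compSize G v = compSize G w := by
  unfold compSize
  rw [SimpleGraph.ConnectedComponent.sound h]

theorem compSize_mono [Finite V] {G G' : SimpleGraph V} (h : G ≤ G') (v : V) :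
    compSize G v ≤ compSize G' v := by
  rw [compSize_eq_ncard, compSize_eq_ncard]
  exact Set.ncard_le_ncard (fun x hx => SimpleGraph.Reachable.mono h hx) (Set.toFinite _)

theorem compSize_sup_edge_of_not_reachable {G : SimpleGraph V} {u w v : V}
    (hu : ¬ G.Reachable v u) (hw : ¬ G.Reachable v w) :
    compSize (G ⊔ SimpleGraph.edge u w) v = compSize G v := by
  simp [compSize_eq_ncard, reachable_sup_edge_iff, hu, hw]

theorem compSize_sup_edge_of_reachable {G : SimpleGraph V} {u w : V} (h : G.Reachable u w)
    (v : V) : compSize (G ⊔ SimpleGraph.edge u w) v = compSize G v := by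
  rw [compSize_eq_ncard, compSize_eq_ncard]
  congr 1
  ext x
  simp only [reachable_sup_edge_iff, Set.mem_ofPred_eq]
  constructor
  · rintro (h0 | ⟨h1, h2⟩ | ⟨h1, h2⟩)
    · exact h0
    · exact h1.trans (h.trans h2)
    · exact h1.trans (h.symm.trans h2)
  · exact Or.inl

theorem compSize_sup_edge [Finite V] {G : SimpleGraph V} {u w v : V} (h : ¬ G.Reachable u w)
    (hv : G.Reachable v u ∨ G.Reachable v w) :
    compSize (G ⊔ SimpleGraph.edge u w) v = compSize G u + compSize G w := by
  rw [compSize_eq_ncard, compSize_eq_ncard, compSize_eq_ncard,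
    ← Set.ncard_union_eq _ (Set.toFinite _) (Set.toFinite _)]
  · congr 1
    ext x
    simp only [reachable_sup_edge_iff, Set.mem_ofPred_eq, Set.mem_union]
    rcases hv with hv | hv
    · constructor
      · rintro (h0 | ⟨h1, h2⟩ | ⟨h1, h2⟩)
        · exact Or.inl (hv.symm.trans h0)
        · exact Or.inr h2
        · exact Or.inl h2
      · rintro (h0 | h0)
        · exact Or.inl (hv.trans h0)
        · exact Or.inr (Or.inl ⟨hv, h0⟩)
    · constructor
      · rintro (h0 | ⟨h1, h2⟩ | ⟨h1, h2⟩)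
        · exact Or.inr (hv.symm.trans h0)
        · exact Or.inr h2
        · exact Or.inl h2
      · rintro (h0 | h0)
        · exact Or.inr (Or.inr ⟨hv, h0⟩)
        · exact Or.inl (hv.trans h0)
  · rw [Set.disjoint_left]
    exact fun x hx hx' => h (SimpleGraph.Reachable.trans hx (SimpleGraph.Reachable.symm hx'))

theorem reachable_of_compSize_sup_edge_ne {G : SimpleGraph V} {u w v : V}
    (h : compSize (G ⊔ SimpleGraph.edge u w) v ≠ compSize G v) :
    ¬ G.Reachable u w ∧ (G.Reachable v u ∨ G.Reachable v w) := by
  refine ⟨fun h' => h (compSize_sup_edge_of_reachable h' v), ?_⟩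
  by_contra! h'
  exact h (compSize_sup_edge_of_not_reachable h'.1 h'.2)

/-! ### The vertices whose component size satisfies a given condition -/

variable [Fintype V]

/-- The vertices of `G` whose component size satisfies `p`. -/
def sizeFilter (p : ℕ → Prop) (G : SimpleGraph V) : Finset V :=
  univ.filter fun v => p (compSize G v)

@[simp] theorem mem_sizeFilter {p : ℕ → Prop} {G : SimpleGraph V} {v : V} :
    v ∈ sizeFilter p G ↔ p (compSize G v) := by
  simp [sizeFilter]

theorem card_reachable (G : SimpleGraph V) (u : V) :
    #(univ.filter fun v => G.Reachable v u) = compSize G u := by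
  rw [compSize_eq_ncard, ← Set.ncard_coe_finset]
  simp [SimpleGraph.reachable_comm]

theorem sizeFilter_subset_sup_edge {p : ℕ → Prop} {G : SimpleGraph V} {u w : V}
    (hu : ¬ p (compSize G u)) (hw : ¬ p (compSize G w)) :
    sizeFilter p G ⊆ sizeFilter p (G ⊔ SimpleGraph.edge u w) := by
  intro v hv
  rw [mem_sizeFilter] at hv ⊢
  by_contra hne
  obtain ⟨-, h | h⟩ := reachable_of_compSize_sup_edge_ne (G := G) (u := u) (w := w) (v := v)
    (fun h => hne (h ▸ hv))
  · exact hu (compSize_congr h ▸ hv)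
  · exact hw (compSize_congr h ▸ hv)

/-- Inserting an edge changes the sizes of at most two components. -/
theorem card_sizeFilter_le_sup_edge {K : ℕ} {p : ℕ → Prop} (hp : ∀ m, p m → m ≤ K)
    (G : SimpleGraph V) (u w : V) :
    #(sizeFilter p G) ≤ #(sizeFilter p (G ⊔ SimpleGraph.edge u w)) + 2 * K := by
  have key : ∀ a, #(univ.filter fun v => G.Reachable v a ∧ p (compSize G v)) ≤ K := by
    intro a
    by_cases ha : p (compSize G a)
    · refine le_trans (card_le_card ?_) ((card_reachable G a).le.trans (hp _ ha))
      intro v; simp only [mem_filter, mem_univ, true_and]; exact And.left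
    · rw [Finset.filter_false_of_mem]
      · simp
      · rintro v - ⟨h1, h2⟩
        exact ha (compSize_congr h1 ▸ h2)
  have hsub : sizeFilter p G ⊆ sizeFilter p (G ⊔ SimpleGraph.edge u w) ∪
      ((univ.filter fun v => G.Reachable v u ∧ p (compSize G v)) ∪
        (univ.filter fun v => G.Reachable v w ∧ p (compSize G v))) := by
    intro v hv
    simp only [mem_union, mem_sizeFilter, mem_filter, mem_univ, true_and] at hv ⊢
    by_cases hne : compSize (G ⊔ SimpleGraph.edge u w) v = compSize G v
    · exact Or.inl (hne ▸ hv)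
    · obtain ⟨-, h | h⟩ := reachable_of_compSize_sup_edge_ne hne
      · exact Or.inr (Or.inl ⟨h, hv⟩)
      · exact Or.inr (Or.inr ⟨h, hv⟩)
  have := (card_le_card hsub).trans ((card_union_le _ _).trans
    (Nat.add_le_add_left (card_union_le _ _) _))
  have := key u
  have := key w
  omega

/-- A class of small components gains vertices only if two small components are joined. -/
theorem sup_edge_gain_eq_empty {K : ℕ} {p : ℕ → Prop} (hp : ∀ m, p m → m ≤ K)
    {G : SimpleGraph V} {u w : V} (h : ¬ (compSize G u ≤ K ∧ compSize G w ≤ K)) :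
    sizeFilter p (G ⊔ SimpleGraph.edge u w) ⊆ sizeFilter p G := by
  intro v hv
  rw [mem_sizeFilter] at hv ⊢
  by_contra hne
  obtain ⟨h1, h2⟩ := reachable_of_compSize_sup_edge_ne (G := G) (u := u) (w := w) (v := v)
    (fun h => hne (h ▸ hv))
  have := compSize_sup_edge h1 h2
  have := hp _ hv
  omega

/-- All new members lie in the one merged component, and its size satisfies `p`, hence is at most
`K`. -/
theorem card_sup_edge_gain_le {K : ℕ} {p : ℕ → Prop} (hp : ∀ m, p m → m ≤ K)
    (G : SimpleGraph V) (u w : V) :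
    #(sizeFilter p (G ⊔ SimpleGraph.edge u w) \ sizeFilter p G) ≤ K := by
  by_cases h : ¬ G.Reachable u w ∧ compSize G u + compSize G w ≤ K
  · have hsub : sizeFilter p (G ⊔ SimpleGraph.edge u w) \ sizeFilter p G ⊆
        (univ.filter fun v => G.Reachable v u) ∪ (univ.filter fun v => G.Reachable v w) := by
      intro v hv
      simp only [mem_sdiff, mem_sizeFilter, mem_union, mem_filter, mem_univ, true_and] at hv ⊢
      exact (reachable_of_compSize_sup_edge_ne fun h => hv.2 (h ▸ hv.1)).2
    refine (card_le_card hsub).trans ((card_union_le _ _).trans ?_)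
    rw [card_reachable, card_reachable]
    exact h.2
  · refine le_trans (le_of_eq ?_) (Nat.zero_le K)
    rw [card_eq_zero, sdiff_eq_empty_iff_subset]
    intro v hv
    rw [mem_sizeFilter] at hv ⊢
    by_contra hne
    obtain ⟨h1, h2⟩ := reachable_of_compSize_sup_edge_ne (G := G) (u := u) (w := w) (v := v)
      (fun h => hne (h ▸ hv))
    have := compSize_sup_edge h1 h2
    have := hp _ hv
    exact h ⟨h1, by omega⟩

/-- The balance of a class of small components when an edge is inserted. -/
theorem card_sizeFilter_sup_edge_add_lost_le {K : ℕ} {p : ℕ → Prop} (hp : ∀ m, p m → m ≤ K)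
    (G : SimpleGraph V) (u w : V) :
    #(sizeFilter p (G ⊔ SimpleGraph.edge u w)) +
        #((sizeFilter p G).filter fun v => K < compSize (G ⊔ SimpleGraph.edge u w) v) ≤
      #(sizeFilter p G) + if compSize G u ≤ K ∧ compSize G w ≤ K then K else 0 := by
  have h1 : #(sizeFilter p (G ⊔ SimpleGraph.edge u w) \ sizeFilter p G) ≤
      if compSize G u ≤ K ∧ compSize G w ≤ K then K else 0 := by
    split_ifs with h
    · exact card_sup_edge_gain_le hp G u w
    · rw [sdiff_eq_empty_iff_subset.2 (sup_edge_gain_eq_empty hp h), card_empty]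
  have h2 : #(sizeFilter p (G ⊔ SimpleGraph.edge u w) ∩ sizeFilter p G) +
      #((sizeFilter p G).filter fun v => K < compSize (G ⊔ SimpleGraph.edge u w) v) ≤
      #(sizeFilter p G) := by
    rw [← card_union_of_disjoint]
    · exact card_le_card (union_subset inter_subset_right (filter_subset _ _))
    · rw [disjoint_left]
      intro v hv hv'
      simp only [mem_inter, mem_sizeFilter, mem_filter] at hv hv'
      have := hp _ hv.1
      omega
  have h3 := card_sdiff_add_card_inter (sizeFilter p (G ⊔ SimpleGraph.edge u w))
    (sizeFilter p G)
  omega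

end Graph

/-! ### Averages over independent uniform draws -/

section Indicator

/-- The indicator of a proposition. -/
def ind (P : Prop) : ℝ := if P then 1 else 0

theorem ind_of {P : Prop} (h : P) : ind P = 1 := if_pos h

theorem ind_of_not {P : Prop} (h : ¬ P) : ind P = 0 := if_neg h

theorem ind_nonneg (P : Prop) : 0 ≤ ind P := by unfold ind; split_ifs <;> norm_num

theorem ind_le_one (P : Prop) : ind P ≤ 1 := by unfold ind; split_ifs <;> norm_num

theorem ind_mono {P Q : Prop} (h : P → Q) : ind P ≤ ind Q := by
  by_cases hP : P
  · rw [ind_of hP, ind_of (h hP)]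
  · rw [ind_of_not hP]
    exact ind_nonneg Q

theorem sum_ind {α : Type*} (s : Finset α) (P : α → Prop) [DecidablePred P] :
    ∑ x ∈ s, ind (P x) = #(s.filter P) := by
  rw [← sum_boole]
  refine sum_congr rfl fun x _ => ?_
  unfold ind
  congr

end Indicator

section Draws

variable {ι V : Type*} [Fintype ι] [DecidableEq ι] [Fintype V]

/-- The proportion of the draws that satisfy `P`. -/
def prob (P : (ι → V) → Prop) : ℝ := 𝔼 v : ι → V, ind (P v)

theorem prob_mono {P Q : (ι → V) → Prop} (h : ∀ v, P v → Q v) : prob P ≤ prob Q :=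
  expect_le_expect fun v _ => ind_mono (h v)

theorem prob_le_add {P Q S : (ι → V) → Prop} (h : ∀ v, P v → Q v ∨ S v) :
    prob P ≤ prob Q + prob S := by
  rw [prob, prob, prob, ← expect_add_distrib]
  refine expect_le_expect fun v _ => ?_
  by_cases hP : P v
  · rw [ind_of hP]
    rcases h v hP with h' | h'
    · rw [ind_of h']
      linarith [ind_nonneg (S v)]
    · rw [ind_of h']
      linarith [ind_nonneg (Q v)]
  · rw [ind_of_not hP]
    exact add_nonneg (ind_nonneg _) (ind_nonneg _)

theorem prob_exists_le {κ : Type*} [Fintype κ] (P : κ → (ι → V) → Prop) :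
    prob (fun v => ∃ k, P k v) ≤ ∑ k, prob (P k) := by
  simp only [prob]
  rw [← expect_sum_comm]
  refine expect_le_expect fun v _ => ?_
  have h0 : ∀ k ∈ (univ : Finset κ), 0 ≤ ind (P k v) := fun k _ => ind_nonneg _
  by_cases h : ∃ k, P k v
  · obtain ⟨k, hk⟩ := h
    refine le_trans ?_ (single_le_sum h0 (mem_univ k))
    rw [ind_of hk]
    exact ind_le_one _
  · rw [ind_of_not h]
    exact sum_nonneg h0

/-- Independence of the coordinates of a uniform draw, obtained by expanding a product of sums. -/
theorem expect_prod_apply (g : ι → V → ℝ) :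
    𝔼 v : ι → V, ∏ i, g i (v i) = ∏ i, 𝔼 x, g i x := by
  simp only [Fintype.expect_eq_sum_div_card]
  rw [prod_div_distrib, prod_univ_sum, Fintype.piFinset_univ]
  simp

theorem prob_forall_mem (A : ι → Finset V) :
    prob (fun v : ι → V => ∀ i, v i ∈ A i) = ∏ i, ((#(A i) : ℝ) / Fintype.card V) := by
  have h : ∀ i, ((#(A i) : ℝ) / Fintype.card V) = 𝔼 x, if x ∈ A i then (1 : ℝ) else 0 := by
    intro i
    rw [Fintype.expect_eq_sum_div_card]
    simp
  simp only [h]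
  rw [← expect_prod_apply]
  refine expect_congr rfl fun v _ => ?_
  rw [prod_ite_zero]
  simp [ind]

variable [Nonempty V]

/-- Two distinct coordinates are jointly uniform: `F` is a combination of point masses, each a
product over all coordinates with factor 1 away from `i` and `j`. -/
theorem expect_eval_pair {i j : ι} (hij : i ≠ j) (F : V → V → ℝ) :
    𝔼 v : ι → V, F (v i) (v j) = 𝔼 x, 𝔼 y, F x y := by
  have h1 : ∀ v : ι → V, F (v i) (v j) =
      ∑ a, ∑ b, F a b * ∏ k, (if k = i then (if v k = a then (1 : ℝ) else 0) else
        if k = j then (if v k = b then 1 else 0) else 1) := by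
    intro v
    have h2 : ∀ a b, ∏ k, (if k = i then (if v k = a then (1 : ℝ) else 0) else
        if k = j then (if v k = b then 1 else 0) else 1) =
        (if v i = a then 1 else 0) * (if v j = b then 1 else 0) := by
      intro a b
      rw [← mul_prod_erase univ _ (mem_univ i), ← mul_prod_erase (univ.erase i) _
        (mem_erase.2 ⟨hij.symm, mem_univ j⟩), prod_eq_one]
      · simp [hij.symm]
      · intro k hk
        simp only [mem_erase] at hk
        simp [hk.1, hk.2.1]
    simp [h2]
  have hc : (Fintype.card V : ℝ) ≠ 0 := by exact_mod_cast Fintype.card_ne_zero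
  have h3 : ∀ a b : V, 𝔼 v : ι → V, ∏ k, (if k = i then (if v k = a then (1 : ℝ) else 0) else
        if k = j then (if v k = b then 1 else 0) else 1) =
        (1 / Fintype.card V) * (1 / Fintype.card V) := by
    intro a b
    rw [expect_prod_apply (fun k x => if k = i then (if x = a then (1 : ℝ) else 0) else
        if k = j then (if x = b then 1 else 0) else 1)]
    rw [← mul_prod_erase univ _ (mem_univ i), ← mul_prod_erase (univ.erase i) _
        (mem_erase.2 ⟨hij.symm, mem_univ j⟩), prod_eq_one]
    · simp [hij.symm]
    · intro k hk
      simp only [mem_erase] at hk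
      simp [hk.1, hk.2.1]
  simp only [h1]
  rw [expect_sum_comm]
  simp only [expect_sum_comm, ← mul_expect, h3]
  simp only [Fintype.expect_eq_sum_div_card, sum_div]
  refine sum_congr rfl fun a _ => sum_congr rfl fun b _ => ?_
  field_simp

theorem prob_eval_mem (i : ι) (A : Finset V) :
    prob (fun v : ι → V => v i ∈ A) = #A / Fintype.card V := by
  have hc : (Fintype.card V : ℝ) ≠ 0 := by exact_mod_cast Fintype.card_ne_zero
  have := prob_forall_mem (fun k : ι => if k = i then A else univ)
  rw [← mul_prod_erase univ _ (mem_univ i), prod_eq_one] at this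
  · rw [if_pos rfl, mul_one] at this
    rw [← this]
    congr 1
    ext v
    constructor
    · intro h k
      split_ifs with hk
      · exact hk ▸ h
      · simp
    · intro h
      simpa using h i
  · intro k hk
    rw [if_neg (ne_of_mem_erase hk)]
    simp [hc]

theorem prob_exists_mem_le (A : Finset V) :
    prob (fun v : ι → V => ∃ i, v i ∈ A) ≤ Fintype.card ι * (#A / Fintype.card V) := by
  refine (prob_exists_le _).trans ?_
  simp [prob_eval_mem]

theorem prob_exists_pair_mem_le (A B : Finset V) :
    prob (fun v : ι → V => ∃ i j, i ≠ j ∧ v i ∈ A ∧ v j ∈ B) ≤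
      (Fintype.card ι : ℝ) ^ 2 * (#A / Fintype.card V * (#B / Fintype.card V)) := by
  have h : ∀ i j : ι, prob (fun v : ι → V => i ≠ j ∧ v i ∈ A ∧ v j ∈ B) ≤
      #A / Fintype.card V * (#B / Fintype.card V) := by
    intro i j
    by_cases hij : i = j
    · have : prob (fun v : ι → V => i ≠ j ∧ v i ∈ A ∧ v j ∈ B) = 0 := by
        simp [prob, ind, hij]
      rw [this]
      positivity
    · have : prob (fun v : ι → V => i ≠ j ∧ v i ∈ A ∧ v j ∈ B) =
          𝔼 v : ι → V, (if v i ∈ A then (1 : ℝ) else 0) * (if v j ∈ B then 1 else 0) := by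
        refine expect_congr rfl fun v _ => ?_
        by_cases h1 : v i ∈ A <;> by_cases h2 : v j ∈ B <;> simp [ind, hij, h1, h2]
      rw [this, expect_eval_pair hij
        (fun x y => (if x ∈ A then (1 : ℝ) else 0) * (if y ∈ B then 1 else 0))]
      refine le_of_eq ?_
      simp only [← mul_expect, ← expect_mul]
      simp [Fintype.expect_eq_sum_div_card]
  refine (prob_exists_le _).trans ((sum_le_sum fun i _ => prob_exists_le _).trans ?_)
  refine (sum_le_sum fun i _ => sum_le_sum fun j _ => h i j).trans (le_of_eq ?_)
  simp only [sum_const, card_univ, nsmul_eq_mul]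
  ring

theorem fstPos_ne_sndPos {ℓ : ℕ} (i : Fin (ℓ / 2)) : fstPos i ≠ sndPos i := by
  simp [fstPos, sndPos, Fin.ext_iff]

/-- It is unlikely that an offered edge lies inside a small component. -/
theorem prob_reachable_le (K ℓ : ℕ) (G : SimpleGraph V) :
    prob (fun v : Fin ℓ → V => ∃ i : Fin (ℓ / 2), compSize G (v (fstPos i)) ≤ K ∧
      G.Reachable (v (sndPos i)) (v (fstPos i))) ≤ ℓ * K / Fintype.card V := by
  have hc : (0 : ℝ) < Fintype.card V := by exact_mod_cast Fintype.card_pos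
  have h : ∀ i : Fin (ℓ / 2), prob (fun v : Fin ℓ → V => compSize G (v (fstPos i)) ≤ K ∧
      G.Reachable (v (sndPos i)) (v (fstPos i))) ≤ K / Fintype.card V := by
    intro i
    -- With the first endpoint fixed in a small component, at most `K` choices of the second
    -- endpoint fall into the same component.
    rw [prob, expect_eval_pair (fstPos_ne_sndPos i)
      (fun x y => ind (compSize G x ≤ K ∧ G.Reachable y x))]
    refine expect_le univ_nonempty fun x _ => ?_
    rw [Fintype.expect_eq_sum_div_card]
    gcongr
    by_cases hx : compSize G x ≤ K
    · simp only [ind, hx, true_and, sum_boole, card_reachable]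
      exact_mod_cast hx
    · simp [ind, hx]
  refine (prob_exists_le _).trans ((sum_le_sum fun i _ => h i).trans ?_)
  simp only [sum_const, card_univ, nsmul_eq_mul, Fintype.card_fin]
  rw [mul_div_assoc]
  gcongr
  exact Nat.div_le_self _ _

end Draws

/-! ### The transition operator -/

section Transition

variable {K ℓ : ℕ} {V : Type*} [Fintype V]

/-- The label of the edge selected by `R`. -/
def chosen (R : Rule K ℓ) (G : SimpleGraph V) (v : Fin ℓ → V) : Fin (ℓ / 2) :=
  R fun i => truncSize K G (v i)

theorem step_eq (R : Rule K ℓ) (G : SimpleGraph V) (v : Fin ℓ → V) :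
    step R G v = G ⊔ SimpleGraph.edge (v (fstPos (chosen R G v))) (v (sndPos (chosen R G v))) :=
  rfl

theorem le_step (R : Rule K ℓ) (G : SimpleGraph V) (v : Fin ℓ → V) : G ≤ step R G v :=
  le_sup_left

/-- The transition operator of the `R`-process. -/
def transition (R : Rule K ℓ) (f : SimpleGraph V → ℝ) (G : SimpleGraph V) : ℝ :=
  𝔼 v : Fin ℓ → V, f (step R G v)

theorem transition_mono (R : Rule K ℓ) {f g : SimpleGraph V → ℝ} {G : SimpleGraph V}
    (h : ∀ v, f (step R G v) ≤ g (step R G v)) : transition R f G ≤ transition R g G :=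
  expect_le_expect fun v _ => h v

theorem transition_const_mul (R : Rule K ℓ) (a : ℝ) (f : SimpleGraph V → ℝ) :
    transition R (fun G => a * f G) = fun G => a * transition R f G := by
  ext G
  simp only [transition, mul_expect]

theorem transition_add (R : Rule K ℓ) (f g : SimpleGraph V → ℝ) :
    transition R (fun G => f G + g G) = fun G => transition R f G + transition R g G := by
  ext G
  simp only [transition, expect_add_distrib]

theorem transition_const [Nonempty V] (R : Rule K ℓ) (a : ℝ) :
    transition R (fun _ : SimpleGraph V => a) = fun _ => a := by
  ext G
  simp [transition]

theorem iterate_transition_const [Nonempty V] (R : Rule K ℓ) (a : ℝ) (t : ℕ) :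
    (transition R)^[t] (fun _ : SimpleGraph V => a) = fun _ => a :=
  Function.iterate_fixed (transition_const R a) t

theorem iterate_transition_const_mul (R : Rule K ℓ) (a : ℝ) (f : SimpleGraph V → ℝ) (t : ℕ) :
    (transition R)^[t] (fun G => a * f G) = fun G => a * (transition R)^[t] f G := by
  induction t with
  | zero => rfl
  | succ t ih => rw [Function.iterate_succ_apply', ih, transition_const_mul,
      Function.iterate_succ_apply']

theorem iterate_transition_add (R : Rule K ℓ) (f g : SimpleGraph V → ℝ) (t : ℕ) :
    (transition R)^[t] (fun G => f G + g G) =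
      fun G => (transition R)^[t] f G + (transition R)^[t] g G := by
  induction t with
  | zero => rfl
  | succ t ih => rw [Function.iterate_succ_apply', ih, transition_add,
      Function.iterate_succ_apply', Function.iterate_succ_apply']

/-- Comparison along an invariant. -/
theorem iterate_transition_mono_of_invariant (R : Rule K ℓ) {I : ℕ → SimpleGraph V → Prop}
    (hI : ∀ t G v, I t G → I (t + 1) (step R G v)) {f g : SimpleGraph V → ℝ} (t : ℕ) :
    ∀ (s : ℕ) (G : SimpleGraph V), I s G → (∀ G', I (s + t) G' → f G' ≤ g G') →
      (transition R)^[t] f G ≤ (transition R)^[t] g G := by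
  induction t with
  | zero => exact fun s G hG h => h G hG
  | succ t ih =>
    intro s G hG h
    rw [Function.iterate_succ_apply', Function.iterate_succ_apply']
    refine transition_mono R fun v => ih (s + 1) _ (hI s G v hG) fun G' hG' => h G' ?_
    rwa [show s + (t + 1) = s + 1 + t by ring]

theorem iterate_transition_mono (R : Rule K ℓ) {f g : SimpleGraph V → ℝ} (h : ∀ G, f G ≤ g G)
    (t : ℕ) (G : SimpleGraph V) : (transition R)^[t] f G ≤ (transition R)^[t] g G :=
  iterate_transition_mono_of_invariant (I := fun _ _ => True) R (fun _ _ _ _ => trivial) t 0 G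
    trivial fun G' _ => h G'

end Transition

/-! ### Sizes of vanishing extinction rate -/

section Classes

variable {K ℓ : ℕ} {V : Type*} [Fintype V]

theorem truncSize_eq_top_iff (G : SimpleGraph V) (v : V) :
    truncSize K G v = ⊤ ↔ K < compSize G v := by
  unfold truncSize
  split_ifs with h
  · simpa using h
  · simpa using h

theorem truncSize_eq_coe_iff (G : SimpleGraph V) (v : V) (k : Set.Icc 1 K) :
    truncSize K G v = (k : SizeClass K) ↔ compSize G v = k.1 := by
  unfold truncSize
  split_ifs with h
  · rw [WithTop.coe_inj, Subtype.ext_iff]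
  · have := k.2.2
    simp only [WithTop.top_ne_coe, false_iff]
    omega

/-- The component sizes whose extinction rate vanishes. -/
def IsPersistent (R : Rule K ℓ) (m : ℕ) : Prop :=
  ∃ h : m ∈ Set.Icc 1 K, ext R ⟨m, h⟩ = 0

theorem IsPersistent.le {R : Rule K ℓ} {m : ℕ} (h : IsPersistent R m) : m ≤ K := h.1.2

/-- The vertices in components with at most `K` vertices. -/
abbrev smallVerts (K : ℕ) (G : SimpleGraph V) : Finset V := sizeFilter (· ≤ K) G

/-- The vertices in small components of vanishing extinction rate. -/
abbrev persistentVerts (R : Rule K ℓ) (G : SimpleGraph V) : Finset V :=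
  sizeFilter (IsPersistent R) G

/-- The vertices in small components of positive extinction rate. -/
abbrev decayingVerts (R : Rule K ℓ) (G : SimpleGraph V) : Finset V :=
  sizeFilter (fun m => m ≤ K ∧ ¬ IsPersistent R m) G

theorem card_smallVerts (R : Rule K ℓ) (G : SimpleGraph V) :
    #(smallVerts K G) = #(persistentVerts R G) + #(decayingVerts R G) := by
  rw [← card_union_of_disjoint]
  · congr 1
    ext v
    simp only [mem_sizeFilter, mem_union]
    constructor
    · intro h
      by_cases h' : IsPersistent R (compSize G v)
      · exact Or.inl h'
      · exact Or.inr ⟨h, h'⟩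
    · rintro (h | h)
      · exact h.le
      · exact h.1
  · rw [disjoint_left]
    intro v hv hv'
    rw [mem_sizeFilter] at hv hv'
    exact hv'.2 hv

theorem smallVerts_step_subset (R : Rule K ℓ) (G : SimpleGraph V) (v : Fin ℓ → V) :
    smallVerts K (step R G v) ⊆ smallVerts K G := by
  intro x hx
  rw [mem_sizeFilter] at hx ⊢
  exact (compSize_mono (le_step R G v) x).trans hx

/-- An edge with both ends outside the class touches no component of the class. -/
theorem exists_mem_sizeFilter_of_step_lt {p : ℕ → Prop} {R : Rule K ℓ} {G : SimpleGraph V}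
    {v : Fin ℓ → V} (h : #(sizeFilter p (step R G v)) < #(sizeFilter p G)) :
    v (fstPos (chosen R G v)) ∈ sizeFilter p G ∨ v (sndPos (chosen R G v)) ∈ sizeFilter p G := by
  by_contra! h'
  rw [mem_sizeFilter, mem_sizeFilter] at h'
  refine absurd h (not_lt.2 (card_le_card ?_))
  rw [step_eq]
  exact sizeFilter_subset_sup_edge h'.1 h'.2

/-- If `v a` were the only small draw, the truncated sizes would form a vector counted by the
extinction rate of a persistent size, which is zero. The unordered pair in `hab` lets `a` be either
end of the chosen edge. -/
theorem exists_ne_mem_smallVerts {R : Rule K ℓ} {G : SimpleGraph V} {v : Fin ℓ → V} {a b : Fin ℓ}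
    (hab : ({a, b} : Set (Fin ℓ)) = {fstPos (chosen R G v), sndPos (chosen R G v)})
    (hne : a ≠ b) (ha : v a ∈ persistentVerts R G) : ∃ j, a ≠ j ∧ v j ∈ smallVerts K G := by
  by_contra! hall
  rw [mem_sizeFilter] at ha
  obtain ⟨hk, hext⟩ := ha
  set k : Set.Icc 1 K := ⟨compSize G (v a), hk⟩ with hkdef
  have hs : truncSize K G (v a) = (k : SizeClass K) := by
    rw [truncSize_eq_coe_iff]
  have ht : ∀ j, j ≠ a → truncSize K G (v j) = ⊤ := by
    intro j hj
    rw [truncSize_eq_top_iff]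
    have := hall j hj.symm
    rw [mem_sizeFilter] at this
    omega
  have hk0 : k.1 ≠ 0 := by have := hk.1; simp only [hkdef]; omega
  rw [ext, mul_eq_zero, Set.ncard_eq_zero (Set.toFinite _)] at hext
  refine Set.eq_empty_iff_forall_notMem.1 (hext.resolve_left hk0)
    (fun i => truncSize K G (v i)) ⟨?_, a, hs, ht⟩
  have himg := congrArg (Set.image fun i => truncSize K G (v i)) hab
  rw [Set.image_pair, Set.image_pair] at himg
  rw [joinVectors, Set.mem_ofPred_eq]
  refine himg.symm.trans ?_
  rw [hs, ht b hne.symm]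

/-- Persistent vertices are lost only in rounds that draw two small vertices. -/
theorem exists_pair_of_card_persistentVerts_lt {R : Rule K ℓ} {G : SimpleGraph V}
    {v : Fin ℓ → V} (h : #(persistentVerts R (step R G v)) < #(persistentVerts R G)) :
    ∃ i j, i ≠ j ∧ v i ∈ persistentVerts R G ∧ v j ∈ smallVerts K G := by
  have hne := fstPos_ne_sndPos (chosen R G v)
  rcases exists_mem_sizeFilter_of_step_lt h with h | h
  · obtain ⟨j, hj⟩ := exists_ne_mem_smallVerts rfl hne h
    exact ⟨_, j, hj.1, h, hj.2⟩
  · obtain ⟨j, hj⟩ := exists_ne_mem_smallVerts (Set.pair_comm _ _) hne.symm h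
    exact ⟨_, j, hj.1, h, hj.2⟩

/-- A decaying vertex is absorbed by a large component if it is drawn at a suitable position
together with vertices of large components only. -/
theorem exists_position_of_mem_decayingVerts {R : Rule K ℓ} {G : SimpleGraph V} {x : V}
    (hx : x ∈ decayingVerts R G) :
    ∃ i : Fin ℓ, ∀ v : Fin ℓ → V, v i = x → (∀ j, j ≠ i → v j ∉ smallVerts K G) →
      K < compSize (step R G v) x := by
  rw [mem_sizeFilter] at hx
  obtain ⟨hxK, hx⟩ := hx
  have hk : compSize G x ∈ Set.Icc 1 K := ⟨one_le_compSize G x, hxK⟩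
  have hext : ext R ⟨_, hk⟩ ≠ 0 := fun h => hx ⟨hk, h⟩
  have hnc := right_ne_zero_of_mul hext
  obtain ⟨s, hs, i, hsi, hsj⟩ := Set.nonempty_of_ncard_ne_zero hnc
  refine ⟨i, fun v hvi hvj => ?_⟩
  -- The draw realises a vector `s` that witnesses the positive extinction rate, so the rule joins
  -- `x` to a large component.
  have hsv : (fun j => truncSize K G (v j)) = s := by
    ext1 j
    by_cases hj : j = i
    · rw [hj, hsi, truncSize_eq_coe_iff, hvi]
    · rw [hsj j hj, truncSize_eq_top_iff]
      have := hvj j hj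
      rw [mem_sizeFilter] at this
      omega
  have hc : chosen R G v = R s := by rw [chosen, hsv]
  have hpos : ∀ j, s j ≠ ⊤ → j = i := fun j hj => by
    by_contra h
    exact hj (hsj j h)
  rw [joinVectors, Set.mem_ofPred_eq] at hs
  have hmem : (((⟨_, hk⟩ : Set.Icc 1 K) : SizeClass K)) ∈
      ({s (fstPos (R s)), s (sndPos (R s))} : Set (SizeClass K)) := by
    rw [hs]; simp
  have hne := fstPos_ne_sndPos (R s)
  have hbig : ∀ j, j ≠ i → K < compSize G (v j) := by
    intro j hj
    have := hvj j hj
    rw [mem_sizeFilter] at this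
    omega
  have hnr : ∀ j, j ≠ i → ¬ G.Reachable x (v j) := by
    intro j hj hr
    have := compSize_congr hr
    have := hbig j hj
    omega
  rw [step_eq, hc]
  rcases hmem with h | h
  · have hi : fstPos (R s) = i := hpos _ (by rw [← h]; simp)
    have hj : sndPos (R s) ≠ i := fun h' => hne (hi.trans h'.symm)
    rw [hi, hvi, compSize_sup_edge (hnr _ hj) (Or.inl .rfl)]
    have := hbig _ hj
    omega
  · have h : _ = s (sndPos (R s)) := h
    have hi : sndPos (R s) = i := hpos _ (by rw [← h]; simp)
    have hj : fstPos (R s) ≠ i := fun h' => hne (h'.trans hi.symm)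
    rw [hi, hvi, compSize_sup_edge (fun h => hnr _ hj h.symm) (Or.inr .rfl)]
    have := hbig _ hj
    omega

/-- The suitable position hits `x` with probability `1 / n`, and every other position avoids the
small vertices with probability at least 1/2. -/
theorem le_prob_absorbed [Nonempty V] (R : Rule K ℓ) (G : SimpleGraph V)
    (hX : (#(smallVerts K G) : ℝ) ≤ Fintype.card V / 2) {x : V} (hx : x ∈ decayingVerts R G) :
    (1 / 2) ^ ℓ / Fintype.card V ≤
      prob (fun v : Fin ℓ → V => K < compSize (step R G v) x) := by
  have hc : (0 : ℝ) < Fintype.card V := by exact_mod_cast Fintype.card_pos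
  obtain ⟨i, hi⟩ := exists_position_of_mem_decayingVerts hx
  have h1 := prob_forall_mem (fun j : Fin ℓ => if j = i then {x} else (smallVerts K G)ᶜ)
  refine le_trans ?_ (h1.ge.trans (prob_mono fun v hv => hi v ?_ fun j hj => ?_))
  · rw [← mul_prod_erase univ _ (mem_univ i)]
    simp only [if_true, card_singleton, Nat.cast_one]
    rw [div_eq_mul_one_div, mul_comm]
    refine mul_le_mul_of_nonneg_left ?_ (by positivity)
    rw [prod_congr rfl (g := fun _ => (#((smallVerts K G)ᶜ) : ℝ) / Fintype.card V)
      (fun j hj => by rw [if_neg (ne_of_mem_erase hj)])]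
    rw [prod_const, card_erase_of_mem (mem_univ i), card_univ, Fintype.card_fin]
    have h2 : (1 / 2 : ℝ) ≤ (#((smallVerts K G)ᶜ) : ℝ) / Fintype.card V := by
      rw [le_div_iff₀ hc, card_compl, Nat.cast_sub (card_le_univ _)]
      linarith
    refine le_trans ?_ (pow_le_pow_left₀ (by norm_num) h2 _)
    exact pow_le_pow_of_le_one (by norm_num) (by norm_num) (Nat.sub_le _ _)
  · simpa using hv i
  · have := hv j
    rw [if_neg hj, mem_compl] at this
    exact this

end Classes

/-! ### Drift estimates -/

section Drift

variable {K ℓ : ℕ} {V : Type*} [Fintype V]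

/-- The function `1 / (#A + 1)` of the number of vertices in a class `A`. -/
def invCard (p : ℕ → Prop) (G : SimpleGraph V) : ℝ := 1 / ((#(sizeFilter p G) : ℝ) + 1)

theorem invCard_pos (p : ℕ → Prop) (G : SimpleGraph V) : 0 < invCard p G := by
  unfold invCard; positivity

/-- A bounded loss raises the reciprocal only by a multiple of its square: the increment is `(a - b)
/ ((a + 1) * (b + 1))`, and `1 / (b + 1) ≤ (m + 1) / (a + 1)`. It is applied with `m = 2 * K`. -/
theorem one_div_succ_le {a b m : ℝ} (ha : 0 ≤ a) (hb : 0 ≤ b) (hm : 0 ≤ m) (h : a ≤ b + m) :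
    1 / (b + 1) ≤ 1 / (a + 1) + m * (m + 1) * (1 / (a + 1)) ^ 2 := by
  have h1 : 1 / (b + 1) - 1 / (a + 1) ≤ m * (1 / (a + 1)) * (1 / (b + 1)) := by
    have : 1 / (b + 1) - 1 / (a + 1) = (a - b) * (1 / (a + 1)) * (1 / (b + 1)) := by
      field_simp
      ring
    rw [this]
    gcongr
    linarith
  have h2 : 1 / (b + 1) ≤ (m + 1) * (1 / (a + 1)) := by
    rw [mul_one_div, div_le_div_iff₀ (by positivity) (by positivity)]
    nlinarith
  have h3 : m * (1 / (a + 1)) * (1 / (b + 1)) ≤ m * (1 / (a + 1)) * ((m + 1) * (1 / (a + 1))) :=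
    mul_le_mul_of_nonneg_left h2 (by positivity)
  nlinarith

theorem invCard_step_le {p : ℕ → Prop} (hp : ∀ m, p m → m ≤ K) (R : Rule K ℓ)
    (G : SimpleGraph V) {E : (Fin ℓ → V) → Prop}
    (hE : ∀ v, #(sizeFilter p (step R G v)) < #(sizeFilter p G) → E v) (v : Fin ℓ → V) :
    invCard p (step R G v) ≤ invCard p G +
      2 * K * (2 * K + 1) * invCard p G ^ 2 * ind (E v) := by
  by_cases h : #(sizeFilter p (step R G v)) < #(sizeFilter p G)
  · rw [ind_of (hE v h), mul_one]
    refine one_div_succ_le (by positivity) (by positivity) (by positivity) ?_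
    have := card_sizeFilter_le_sup_edge hp G (v (fstPos (chosen R G v)))
      (v (sndPos (chosen R G v)))
    rw [← step_eq] at this
    exact_mod_cast this
  · have h1 : invCard p (step R G v) ≤ invCard p G := by
      unfold invCard
      have : (#(sizeFilter p G) : ℝ) ≤ #(sizeFilter p (step R G v)) := by
        exact_mod_cast not_lt.1 h
      gcongr
    exact h1.trans (le_add_of_nonneg_right (mul_nonneg (by positivity) (ind_nonneg _)))

theorem transition_invCard_le_prob [Nonempty V] {p : ℕ → Prop} (hp : ∀ m, p m → m ≤ K)
    (R : Rule K ℓ) (G : SimpleGraph V) {E : (Fin ℓ → V) → Prop}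
    (hE : ∀ v, #(sizeFilter p (step R G v)) < #(sizeFilter p G) → E v) :
    transition R (invCard p) G ≤ invCard p G +
      2 * K * (2 * K + 1) * invCard p G ^ 2 * prob E := by
  refine (expect_le_expect fun v _ => invCard_step_le hp R G hE v).trans (le_of_eq ?_)
  rw [expect_add_distrib, Fintype.expect_const, ← mul_expect, prob]

/-- The crude estimate for the loss of a class of small components. -/
theorem transition_invCard_le [Nonempty V] {p : ℕ → Prop} (hp : ∀ m, p m → m ≤ K)
    (R : Rule K ℓ) (G : SimpleGraph V) :
    transition R (invCard p) G ≤
      (1 + 2 * K * (2 * K + 1) * ℓ / Fintype.card V) * invCard p G := by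
  have hc : (0 : ℝ) < Fintype.card V := by exact_mod_cast Fintype.card_pos
  have h := transition_invCard_le_prob hp R G
    (E := fun v => ∃ i, v i ∈ sizeFilter p G) (fun v hv => by
      rcases exists_mem_sizeFilter_of_step_lt hv with h | h
      · exact ⟨_, h⟩
      · exact ⟨_, h⟩)
  -- The loss probability is proportional to the size of the class, which cancels one of the two
  -- factors `invCard p G`.
  have h2 := prob_exists_mem_le (ι := Fin ℓ) (sizeFilter p G)
  rw [Fintype.card_fin] at h2
  have hpos := invCard_pos p G
  have h3 : invCard p G * #(sizeFilter p G) ≤ 1 := by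
    rw [invCard, one_div_mul_eq_div, div_le_one (by positivity)]
    linarith
  calc _ ≤ _ := h
    _ ≤ invCard p G + 2 * K * (2 * K + 1) * invCard p G ^ 2 *
        (ℓ * (#(sizeFilter p G) / Fintype.card V)) := by gcongr
    _ = invCard p G + 2 * K * (2 * K + 1) * ℓ / Fintype.card V * invCard p G *
        (invCard p G * #(sizeFilter p G)) := by ring
    _ ≤ invCard p G + 2 * K * (2 * K + 1) * ℓ / Fintype.card V * invCard p G * 1 := by gcongr
    _ = _ := by ring

/-- The ratio of the numbers of decaying and of persistent vertices. -/
def decayRatio (R : Rule K ℓ) (G : SimpleGraph V) : ℝ :=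
  #(decayingVerts R G) * invCard (IsPersistent R) G

theorem decayRatio_nonneg (R : Rule K ℓ) (G : SimpleGraph V) : 0 ≤ decayRatio R G :=
  mul_nonneg (by positivity) (invCard_pos _ _).le

theorem card_persistentVerts_mul_invCard_le (R : Rule K ℓ) (G : SimpleGraph V) :
    invCard (IsPersistent R) G * #(persistentVerts R G) ≤ 1 := by
  rw [invCard, one_div_mul_eq_div, div_le_one (by positivity)]
  linarith

theorem card_smallVerts_mul_invCard_le (R : Rule K ℓ) (G : SimpleGraph V) :
    invCard (IsPersistent R) G * #(smallVerts K G) ≤ 1 + decayRatio R G := by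
  rw [card_smallVerts R, Nat.cast_add, mul_add, decayRatio, mul_comm _ (#(decayingVerts R G) : ℝ)]
  exact add_le_add_left (card_persistentVerts_mul_invCard_le R G) _

/-- The two reciprocal factors cancel the counts `Y` and `X` of the union bound, since `y * Y ≤ 1`
and `y * X ≤ 1 + r`; only `n ^ 2` is left in the denominator. -/
theorem prob_persistent_pair_le [Nonempty V] (R : Rule K ℓ) (G : SimpleGraph V) :
    invCard (IsPersistent R) G ^ 2 * prob (fun v : Fin ℓ → V => ∃ i j, i ≠ j ∧
      v i ∈ persistentVerts R G ∧ v j ∈ smallVerts K G) ≤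
      ℓ ^ 2 * (1 + decayRatio R G) / (Fintype.card V : ℝ) ^ 2 := by
  have h2 := prob_exists_pair_mem_le (ι := Fin ℓ) (persistentVerts R G) (smallVerts K G)
  rw [Fintype.card_fin] at h2
  have hpos := invCard_pos (IsPersistent R) G
  have hY := card_persistentVerts_mul_invCard_le R G
  have hX := card_smallVerts_mul_invCard_le R G
  calc _ ≤ invCard (IsPersistent R) G ^ 2 * _ := mul_le_mul_of_nonneg_left h2 (by positivity)
    _ = ℓ ^ 2 / (Fintype.card V : ℝ) ^ 2 *
        ((invCard (IsPersistent R) G * #(persistentVerts R G)) *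
          (invCard (IsPersistent R) G * #(smallVerts K G))) := by ring
    _ ≤ ℓ ^ 2 / (Fintype.card V : ℝ) ^ 2 * (1 * (1 + decayRatio R G)) := by
        gcongr
    _ = _ := by ring

/-- The loss of persistent vertices requires two small vertices. -/
theorem transition_invCard_persistent_le [Nonempty V] (R : Rule K ℓ) (G : SimpleGraph V) :
    transition R (invCard (IsPersistent R)) G ≤ invCard (IsPersistent R) G +
      2 * K * (2 * K + 1) * ℓ ^ 2 * (1 + decayRatio R G) / (Fintype.card V : ℝ) ^ 2 := by
  have h := transition_invCard_le_prob (fun m hm => IsPersistent.le hm) R G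
    (fun v hv => exists_pair_of_card_persistentVerts_lt hv)
  refine h.trans ?_
  have := mul_le_mul_of_nonneg_left (prob_persistent_pair_le R G)
    (by positivity : (0 : ℝ) ≤ 2 * K * (2 * K + 1))
  rw [mul_assoc (2 * (K : ℝ) * (2 * K + 1))]
  refine add_le_add_right (this.trans (le_of_eq ?_)) _
  ring

/-- The negative term is absorption by large components. The positive term collects the at most `K`
new decaying vertices of a round that joins two small components, and the growth of `y`; both carry
a factor `δ` because small vertices are sparse. -/
theorem transition_decayRatio_le [Nonempty V] (R : Rule K ℓ) (G : SimpleGraph V) {δ : ℝ}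
    (hδ : δ ≤ 1 / 2)
    (hX : (#(smallVerts K G) : ℝ) ≤ δ * Fintype.card V) :
    transition R (decayRatio R) G ≤ decayRatio R G
      - (1 / 2) ^ ℓ / Fintype.card V * decayRatio R G
      + (K + 2 * K * (2 * K + 1)) * ℓ ^ 2 * δ * (1 + decayRatio R G) / Fintype.card V := by
  have hc : (0 : ℝ) < Fintype.card V := by exact_mod_cast Fintype.card_pos
  have hδ0 : 0 ≤ δ := nonneg_of_mul_nonneg_left (le_trans (by positivity) hX) hc
  set E : (Fin ℓ → V) → Prop := fun v => ∃ i j, i ≠ j ∧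
      v i ∈ persistentVerts R G ∧ v j ∈ smallVerts K G with hE
  set F : (Fin ℓ → V) → Prop := fun v => ∃ i j, i ≠ j ∧
      v i ∈ smallVerts K G ∧ v j ∈ smallVerts K G with hF
  set y := invCard (IsPersistent R) G with hy
  have hypos : 0 < y := invCard_pos _ _
  -- The new number of decaying vertices is estimated twice: by its exact balance where it
  -- multiplies `y`, and crudely by `δ n` where it multiplies the increment of `y`.
  have hpt : ∀ v, decayRatio R (step R G v) ≤
      (#(decayingVerts R G) + (K : ℝ) * ind (F v)
        - ∑ x ∈ decayingVerts R G, ind (K < compSize (step R G v) x)) * y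
      + δ * Fintype.card V * (2 * K * (2 * K + 1)) * y ^ 2 * ind (E v) := by
    intro v
    have hW : (#(decayingVerts R (step R G v)) : ℝ) ≤
        #(decayingVerts R G) + (K : ℝ) * ind (F v)
        - ∑ x ∈ decayingVerts R G, ind (K < compSize (step R G v) x) := by
      have h1 := card_sizeFilter_sup_edge_add_lost_le
        (K := K) (p := fun m => m ≤ K ∧ ¬ IsPersistent R m) (fun m hm => hm.1) G
        (v (fstPos (chosen R G v))) (v (sndPos (chosen R G v)))
      rw [← step_eq] at h1
      have h2 : ((if compSize G (v (fstPos (chosen R G v))) ≤ K ∧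
          compSize G (v (sndPos (chosen R G v))) ≤ K then K else 0 : ℕ) : ℝ) ≤
          K * ind (F v) := by
        split_ifs with h3
        · rw [ind_of (P := F v) ⟨_, _, fstPos_ne_sndPos (chosen R G v), mem_sizeFilter.2 h3.1,
            mem_sizeFilter.2 h3.2⟩, mul_one]
        · rw [Nat.cast_zero]
          exact mul_nonneg (by positivity) (ind_nonneg _)
      have h3 : (#(decayingVerts R (step R G v)) : ℝ) +
          #((decayingVerts R G).filter fun x => K < compSize (step R G v) x) ≤
          #(decayingVerts R G) + (K : ℝ) * ind (F v) :=
        le_trans (by exact_mod_cast h1) (add_le_add_right h2 _)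
      rw [sum_ind]
      linarith
    have hWX : (#(decayingVerts R (step R G v)) : ℝ) ≤ δ * Fintype.card V := by
      refine le_trans ?_ hX
      have := card_smallVerts R (step R G v)
      have := card_le_card (smallVerts_step_subset R G v)
      exact_mod_cast (by omega : #(decayingVerts R (step R G v)) ≤ #(smallVerts K G))
    have hI := invCard_step_le (fun m hm => IsPersistent.le hm) R G (E := E)
      (fun v hv => exists_pair_of_card_persistentVerts_lt hv) v
    rw [← hy] at hI
    have h0 : (0 : ℝ) ≤ 2 * K * (2 * K + 1) * y ^ 2 * ind (E v) := by
      exact mul_nonneg (by positivity) (ind_nonneg _)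
    calc decayRatio R (step R G v)
        ≤ #(decayingVerts R (step R G v)) *
          (y + 2 * K * (2 * K + 1) * y ^ 2 * ind (E v)) :=
          mul_le_mul_of_nonneg_left hI (by positivity)
      _ = #(decayingVerts R (step R G v)) * y + #(decayingVerts R (step R G v)) *
          (2 * K * (2 * K + 1) * y ^ 2 * ind (E v)) := by ring
      _ ≤ _ := add_le_add (mul_le_mul_of_nonneg_right hW hypos.le)
          (mul_le_mul_of_nonneg_right hWX h0)
      _ = _ := by ring
  have hsum : transition R (decayRatio R) G ≤
      (#(decayingVerts R G) + (K : ℝ) * prob F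
        - ∑ x ∈ decayingVerts R G, prob fun v : Fin ℓ → V => K < compSize (step R G v) x) * y
      + δ * Fintype.card V * (2 * K * (2 * K + 1)) * y ^ 2 * prob E := by
    refine (expect_le_expect fun v _ => hpt v).trans (le_of_eq ?_)
    rw [expect_add_distrib, ← mul_expect, ← expect_mul, expect_sub_distrib, expect_add_distrib,
      Fintype.expect_const, ← mul_expect, expect_sum_comm]
    rfl
  have hlost : (#(decayingVerts R G) : ℝ) * ((1 / 2) ^ ℓ / Fintype.card V) ≤
      ∑ x ∈ decayingVerts R G, prob fun v : Fin ℓ → V => K < compSize (step R G v) x := by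
    rw [← nsmul_eq_mul]
    refine card_nsmul_le_sum _ _ _ fun x hx => le_prob_absorbed R G (hX.trans ?_) hx
    nlinarith
  -- Only one of the two factors `X / n` is replaced by `δ`; the other is needed against `y`.
  have hFp : prob F ≤ ℓ ^ 2 * (#(smallVerts K G) / Fintype.card V * δ) := by
    have h2 := prob_exists_pair_mem_le (ι := Fin ℓ) (smallVerts K G) (smallVerts K G)
    rw [Fintype.card_fin] at h2
    refine h2.trans ?_
    gcongr
    rwa [div_le_iff₀ hc]
  have hEp := prob_persistent_pair_le R G
  have hXy := card_smallVerts_mul_invCard_le R G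
  rw [← hy] at hXy hEp
  calc _ ≤ _ := hsum
    _ ≤ (#(decayingVerts R G) + (K : ℝ) * (ℓ ^ 2 * (#(smallVerts K G) / Fintype.card V * δ))
        - (#(decayingVerts R G) : ℝ) * ((1 / 2) ^ ℓ / Fintype.card V)) * y
        + δ * Fintype.card V * (2 * K * (2 * K + 1)) *
          (ℓ ^ 2 * (1 + decayRatio R G) / (Fintype.card V : ℝ) ^ 2) := by
        rw [mul_assoc (δ * Fintype.card V * (2 * K * (2 * K + 1)))]
        gcongr
    _ = decayRatio R G - (1 / 2) ^ ℓ / Fintype.card V * decayRatio R G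
        + K * ℓ ^ 2 * δ / Fintype.card V * (y * #(smallVerts K G))
        + 2 * K * (2 * K + 1) * ℓ ^ 2 * δ * (1 + decayRatio R G) / Fintype.card V := by
        rw [decayRatio, ← hy]
        field_simp
        ring
    _ ≤ decayRatio R G - (1 / 2) ^ ℓ / Fintype.card V * decayRatio R G
        + K * ℓ ^ 2 * δ / Fintype.card V * (1 + decayRatio R G)
        + 2 * K * (2 * K + 1) * ℓ ^ 2 * δ * (1 + decayRatio R G) / Fintype.card V := by
        gcongr
    _ = _ := by ring

end Drift

/-! ### Survival of persistent components in a sparse small part -/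

section Survival

variable {K ℓ : ℕ}

/-- The drift of `y` involves the unbounded ratio `r`. Adding a multiple of `r / n` compensates for
this, because `r` itself has drift of order `-r / n`. -/
theorem exists_iterate_invCard_persistent_le (hK : 1 ≤ K) (hℓ : 1 ≤ ℓ) :
    ∃ δ : ℝ, 0 < δ ∧ ∃ A : ℝ, 0 ≤ A ∧ ∃ b : ℝ, 0 < b ∧
      ∀ (R : Rule K ℓ) (V : Type) [Fintype V] [Nonempty V] (t : ℕ) (G : SimpleGraph V),
        (#(smallVerts K G) : ℝ) ≤ δ * Fintype.card V →
        (transition R)^[t] (invCard (IsPersistent R)) G ≤ invCard (IsPersistent R) G +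
          A / Fintype.card V * decayRatio R G + t * (b / (Fintype.card V : ℝ) ^ 2) := by
  have hK' : (1 : ℝ) ≤ K := by exact_mod_cast hK
  have hℓ' : (1 : ℝ) ≤ ℓ := by exact_mod_cast hℓ
  set κ : ℝ := (1 / 2) ^ ℓ with hκ
  have hκ0 : 0 < κ := by positivity
  set c : ℝ := 2 * K * (2 * K + 1) with hc
  have hc0 : 0 < c := by positivity
  set B : ℝ := (K + c) * ℓ ^ 2 with hB
  have hB0 : 0 < B := by positivity
  -- With this `δ` the growth terms of the ratio use up at most half of the absorption rate `κ`.
  set δ : ℝ := min (1 / 2) (κ / (2 * B)) with hδ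
  have hδ0 : 0 < δ := by positivity
  have hBδ : B * δ ≤ κ / 2 := by
    have : δ ≤ κ / (2 * B) := min_le_right _ _
    calc B * δ ≤ B * (κ / (2 * B)) := by gcongr
      _ = κ / 2 := by field_simp
  -- The weight `2 * c * ℓ ^ 2 / κ` makes the terms in `r` cancel exactly in the drift of the
  -- potential `Φ`.
  refine ⟨δ, hδ0, 2 * c * ℓ ^ 2 / κ, by positivity, 2 * (c * ℓ ^ 2), by positivity, ?_⟩
  intro R V _ _
  have hn : (0 : ℝ) < Fintype.card V := by exact_mod_cast Fintype.card_pos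
  set n : ℝ := (Fintype.card V : ℝ)
  set Φ : SimpleGraph V → ℝ := fun G => invCard (IsPersistent R) G +
    2 * c * ℓ ^ 2 / κ / n * decayRatio R G with hΦ
  have hstep : ∀ G : SimpleGraph V, (#(smallVerts K G) : ℝ) ≤ δ * n →
      transition R Φ G ≤ Φ G + 2 * (c * ℓ ^ 2) / n ^ 2 := by
    intro G hG
    have h1 := transition_invCard_persistent_le R G
    have h2 := transition_decayRatio_le R G (min_le_left _ _) hG
    have hr := decayRatio_nonneg R G
    have h3 : transition R Φ G = transition R (invCard (IsPersistent R)) G +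
        2 * c * ℓ ^ 2 / κ / n * transition R (decayRatio R) G := by
      rw [hΦ, transition_add, transition_const_mul]
    have h4 : transition R (decayRatio R) G ≤ decayRatio R G - κ / n * decayRatio R G +
        κ / 2 * (1 + decayRatio R G) / n := by
      refine h2.trans (add_le_add_right ?_ _)
      gcongr
    rw [h3]
    calc _ ≤ (invCard (IsPersistent R) G + c * ℓ ^ 2 * (1 + decayRatio R G) / n ^ 2) +
          2 * c * ℓ ^ 2 / κ / n * (decayRatio R G - κ / n * decayRatio R G +
          κ / 2 * (1 + decayRatio R G) / n) := by gcongr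
      _ = Φ G + 2 * (c * ℓ ^ 2) / n ^ 2 := by
        rw [hΦ]
        field_simp
        ring
  have hiter : ∀ (t : ℕ) (G : SimpleGraph V), (#(smallVerts K G) : ℝ) ≤ δ * n →
      (transition R)^[t] Φ G ≤ Φ G + t * (2 * (c * ℓ ^ 2) / n ^ 2) := by
    intro t
    induction t with
    | zero => intro G _; simp
    | succ t ih =>
      intro G hG
      rw [Function.iterate_succ_apply']
      have h1 : transition R ((transition R)^[t] Φ) G ≤
          transition R (fun G => Φ G + t * (2 * (c * ℓ ^ 2) / n ^ 2)) G := by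
        refine transition_mono R fun v => ih _ (le_trans ?_ hG)
        exact_mod_cast card_le_card (smallVerts_step_subset R G v)
      rw [transition_add, transition_const] at h1
      have h2 := hstep G hG
      push_cast
      linarith
  intro t G hG
  refine le_trans (iterate_transition_mono R (fun G => ?_) t G) (hiter t G hG)
  rw [hΦ]
  have := decayRatio_nonneg R G
  have : 0 ≤ 2 * c * ℓ ^ 2 / κ / n * decayRatio R G := by positivity
  simpa using this

/-- If few vertices lie in small components, but linearly many of these are persistent, then
persistent components survive for a quadratic number of rounds. -/
theorem exists_survival (hK : 1 ≤ K) (hℓ : 1 ≤ ℓ) :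
    ∃ δ : ℝ, 0 < δ ∧ ∀ γ : ℝ, 0 < γ → ∃ c : ℝ, 0 < c ∧ ∃ n₀ : ℕ,
      ∀ (R : Rule K ℓ) (V : Type) [Fintype V] [Nonempty V], n₀ ≤ Fintype.card V →
        ∀ (t : ℕ) (G : SimpleGraph V), (t : ℝ) ≤ c * (Fintype.card V : ℝ) ^ 2 →
        (#(smallVerts K G) : ℝ) ≤ δ * Fintype.card V →
        γ * Fintype.card V ≤ #(persistentVerts R G) →
        1 / 2 ≤ (transition R)^[t] (fun G => ind (persistentVerts R G).Nonempty) G := by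
  obtain ⟨δ, hδ, A, hA, b, hb, h⟩ := exists_iterate_invCard_persistent_le hK hℓ
  -- The accumulated drift and the initial value of the potential are each allowed 1/4.
  refine ⟨δ, hδ, fun γ hγ => ⟨1 / (4 * b), by positivity, ⌈4 * (1 + A) / γ⌉₊, ?_⟩⟩
  intro R V _ _ hn₀ t G ht hX hY
  have hn : (0 : ℝ) < Fintype.card V := by exact_mod_cast Fintype.card_pos
  have hn₁ : 4 * (1 + A) / γ ≤ Fintype.card V :=
    (Nat.le_ceil _).trans (by exact_mod_cast hn₀)
  have hW : (#(decayingVerts R G) : ℝ) ≤ Fintype.card V := by exact_mod_cast card_le_univ _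
  set n : ℝ := (Fintype.card V : ℝ)
  have hinv : invCard (IsPersistent R) G ≤ 1 / (γ * n) := by
    unfold invCard
    gcongr
    linarith
  have hr : decayRatio R G ≤ 1 / γ := by
    calc decayRatio R G ≤ n * (1 / (γ * n)) := by
          unfold decayRatio
          gcongr
          exact (invCard_pos _ _).le
      _ = 1 / γ := by field_simp
  have h1 := h R V t G hX
  have h2 : (transition R)^[t] (invCard (IsPersistent R)) G ≤ 1 / 2 := by
    calc _ ≤ _ := h1
      _ ≤ 1 / (γ * n) + A / n * (1 / γ) + 1 / (4 * b) * n ^ 2 * (b / n ^ 2) := by gcongr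
      _ = (1 + A) / γ / n + 1 / 4 := by field_simp
      _ ≤ 1 / 4 + 1 / 4 := by
        refine add_le_add_left ?_ _
        rw [div_le_iff₀ hn]
        linarith [mul_div_assoc 4 (1 + A) γ]
      _ = 1 / 2 := by norm_num
  -- Markov's inequality: the reciprocal equals 1 when no persistent vertex is left.
  have h3 := iterate_transition_mono R (f := fun _ => (1 : ℝ))
    (g := fun G => invCard (IsPersistent R) G + ind (persistentVerts R G).Nonempty) (fun G => by
      by_cases hne : (persistentVerts R G).Nonempty
      · rw [ind_of hne]
        linarith [invCard_pos (IsPersistent R) G]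
      · have : sizeFilter (IsPersistent R) G = ∅ := not_nonempty_iff_eq_empty.1 hne
        rw [ind_of_not hne, invCard, this]
        simp) t G
  rw [iterate_transition_const, iterate_transition_add] at h3
  linarith

end Survival

/-! ### The decline of the small part -/

section Decline

variable {K ℓ : ℕ}

/-- A potential that decreases whenever two small components are joined. -/
def smallPotential {V : Type*} [Fintype V] (K : ℕ) (G : SimpleGraph V) : ℕ :=
  ∑ v, (K + 1 - compSize G v)

theorem smallPotential_le {V : Type*} [Fintype V] (K : ℕ) (G : SimpleGraph V) :
    smallPotential K G ≤ (K + 1) * Fintype.card V := by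
  refine (sum_le_sum fun v _ => Nat.sub_le (K + 1) _).trans ?_
  simp [mul_comm]

theorem smallPotential_step_le {V : Type*} [Fintype V] (R : Rule K ℓ) (G : SimpleGraph V)
    (v : Fin ℓ → V) : smallPotential K (step R G v) ≤ smallPotential K G :=
  sum_le_sum fun x _ => Nat.sub_le_sub_left (compSize_mono (le_step R G v) x) _

/-- The hypotheses concern all offered edges, so whichever edge the rule selects merges two distinct
small components. -/
theorem smallPotential_step_lt {V : Type*} [Fintype V] {R : Rule K ℓ} {G : SimpleGraph V}
    {v : Fin ℓ → V} (hs : ∀ i, v i ∈ smallVerts K G)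
    (hr : ∀ i : Fin (ℓ / 2), ¬ G.Reachable (v (sndPos i)) (v (fstPos i))) :
    smallPotential K (step R G v) < smallPotential K G := by
  refine sum_lt_sum
    (fun x _ => Nat.sub_le_sub_left (compSize_mono (le_step R G v) x) _)
    ⟨v (fstPos (chosen R G v)), mem_univ _, ?_⟩
  have h1 := hs (fstPos (chosen R G v))
  rw [mem_sizeFilter] at h1
  rw [step_eq, compSize_sup_edge (fun h => hr _ h.symm) (Or.inl .rfl)]
  have := one_le_compSize G (v (sndPos (chosen R G v)))
  omega

theorem transition_smallPotential_le {V : Type*} [Fintype V] [Nonempty V] (R : Rule K ℓ)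
    (G : SimpleGraph V) :
    transition R (fun G => (smallPotential K G : ℝ)) G ≤ smallPotential K G -
      (((#(smallVerts K G) : ℝ) / Fintype.card V) ^ ℓ - ℓ * K / Fintype.card V) := by
  set C : (Fin ℓ → V) → Prop := fun v => (∀ i, v i ∈ smallVerts K G) ∧
    ∀ i : Fin (ℓ / 2), ¬ G.Reachable (v (sndPos i)) (v (fstPos i)) with hC
  have h1 : ∀ v, (smallPotential K (step R G v) : ℝ) ≤ smallPotential K G - ind (C v) := by
    intro v
    by_cases h : C v
    · rw [ind_of h]
      have := smallPotential_step_lt (R := R) h.1 h.2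
      rw [le_sub_iff_add_le]
      exact_mod_cast this
    · rw [ind_of_not h, sub_zero]
      exact_mod_cast smallPotential_step_le R G v
  have h2 : transition R (fun G => (smallPotential K G : ℝ)) G ≤
      smallPotential K G - prob C := by
    refine (expect_le_expect fun v _ => h1 v).trans (le_of_eq ?_)
    rw [expect_sub_distrib, Fintype.expect_const, prob]
  have h3 := prob_forall_mem (fun _ : Fin ℓ => smallVerts K G)
  rw [prod_const, card_univ, Fintype.card_fin] at h3
  have h4 := prob_le_add (P := fun v : Fin ℓ → V => ∀ i, v i ∈ smallVerts K G) (Q := C)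
    (S := fun v : Fin ℓ → V => ∃ i : Fin (ℓ / 2), compSize G (v (fstPos i)) ≤ K ∧
      G.Reachable (v (sndPos i)) (v (fstPos i))) (fun v hv => by
      by_cases h : ∀ i : Fin (ℓ / 2), ¬ G.Reachable (v (sndPos i)) (v (fstPos i))
      · exact Or.inl ⟨hv, h⟩
      · push Not at h
        obtain ⟨i, hi⟩ := h
        exact Or.inr ⟨i, mem_sizeFilter.1 (hv _), hi⟩)
  have h5 := prob_reachable_le K ℓ G
  linarith

/-- Each round with more than `δ n` small vertices costs the potential at least `p` on average. This
condition can only be lost in time, so its probability at time `t` bounds the earlier ones from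
below, and `t` rounds cost at least `t * p` times it. -/
theorem mul_iterate_ind_smallVerts_le {V : Type*} [Fintype V] [Nonempty V] (R : Rule K ℓ)
    {δ p : ℝ} (hδ : 0 ≤ δ) (hp0 : 0 ≤ p) (hp : p ≤ δ ^ ℓ - ℓ * K / Fintype.card V) (t : ℕ) :
    ∀ G : SimpleGraph V, t * p * (transition R)^[t]
      (fun G => ind (δ * Fintype.card V < #(smallVerts K G))) G ≤ smallPotential K G := by
  have hn : (0 : ℝ) < Fintype.card V := by exact_mod_cast Fintype.card_pos
  set g : SimpleGraph V → ℝ := fun G => ind (δ * Fintype.card V < #(smallVerts K G)) with hg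
  have hdrift : ∀ G, transition R (fun G => (smallPotential K G : ℝ)) G ≤
      smallPotential K G - p * g G := by
    intro G
    by_cases h : δ * Fintype.card V < #(smallVerts K G)
    · rw [hg]
      simp only [ind_of h]
      have h1 := transition_smallPotential_le R G
      have h2 : δ ^ ℓ ≤ ((#(smallVerts K G) : ℝ) / Fintype.card V) ^ ℓ := by
        refine pow_le_pow_left₀ hδ ?_ _
        rw [le_div_iff₀ hn]
        exact h.le
      linarith
    · rw [hg]
      simp only [ind_of_not h, mul_zero, sub_zero]
      rw [← Fintype.expect_const (ι := Fin ℓ → V) (smallPotential K G : ℝ)]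
      exact expect_le_expect fun v _ => Nat.cast_le.2 (smallPotential_step_le R G v)
  have hanti : ∀ G v, g (step R G v) ≤ g G := fun G v => ind_mono fun h => h.trans_le (by
    exact_mod_cast card_le_card (smallVerts_step_subset R G v))
  have hle : ∀ (t : ℕ) G, (transition R)^[t] g G ≤ g G := by
    intro t
    induction t with
    | zero => exact fun G => le_rfl
    | succ t ih =>
      intro G
      rw [Function.iterate_succ_apply', ← Fintype.expect_const (ι := Fin ℓ → V) (g G)]
      exact expect_le_expect fun v _ => (ih _).trans (hanti G v)
  induction t with
  | zero => intro G; simp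
  | succ t ih =>
    intro G
    have h1 := transition_mono R (f := fun G => t * p * (transition R)^[t] g G)
      (g := fun G => (smallPotential K G : ℝ)) (G := G) fun v => ih (step R G v)
    rw [transition_const_mul] at h1
    have h2 := hle (t + 1) G
    have h3 := hdrift G
    rw [Function.iterate_succ_apply'] at h2 ⊢
    have h4 := mul_le_mul_of_nonneg_left h2 hp0
    push_cast
    linarith

theorem iterate_invCard_le {V : Type*} [Fintype V] [Nonempty V] {p : ℕ → Prop}
    (hp : ∀ m, p m → m ≤ K) (R : Rule K ℓ) (t : ℕ) : ∀ G : SimpleGraph V,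
    (transition R)^[t] (invCard p) G ≤
      (1 + 2 * K * (2 * K + 1) * ℓ / Fintype.card V) ^ t * invCard p G := by
  induction t with
  | zero => intro G; simp
  | succ t ih =>
    intro G
    rw [Function.iterate_succ_apply']
    refine (transition_mono R (g := fun G => (1 + 2 * K * (2 * K + 1) * ℓ / Fintype.card V) ^ t *
      invCard p G) fun v => ih (step R G v)).trans ?_
    rw [transition_const_mul, pow_succ, mul_assoc (_ ^ t)]
    exact mul_le_mul_of_nonneg_left (transition_invCard_le hp R G) (by positivity)

/-- After linearly many rounds few vertices lie in small components, while linearly many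
persistent vertices remain. -/
theorem exists_decline {δ γ : ℝ} (hδ : 0 < δ) (hγ : 0 < γ) (K ℓ : ℕ) :
    ∃ T : ℕ, ∃ γ' : ℝ, 0 < γ' ∧ ∃ n₀ : ℕ, ∀ (R : Rule K ℓ) (V : Type) [Fintype V] [Nonempty V],
      n₀ ≤ Fintype.card V → ∀ G : SimpleGraph V, γ * Fintype.card V ≤ #(persistentVerts R G) →
      1 / 2 ≤ (transition R)^[T * Fintype.card V] (fun G => ind
        ((#(smallVerts K G) : ℝ) ≤ δ * Fintype.card V ∧
          γ' * Fintype.card V ≤ #(persistentVerts R G))) G := by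
  -- At a cost of `δ ^ ℓ / 2` per round, `T n` rounds cost four times the largest possible
  -- potential, so the probability of `X > δ n` is at most 1/4.
  set T : ℕ := ⌈8 * (K + 1) / δ ^ ℓ⌉₊ with hT
  set C : ℝ := 2 * K * (2 * K + 1) * ℓ with hC
  set e : ℝ := Real.exp (C * T) with he
  have he0 : 0 < e := Real.exp_pos _
  -- The first threshold keeps the cost per round above `δ ^ ℓ / 2`. The choice of `γ'` and the
  -- second threshold bound the two terms of `(γ' * n + 1) * e / (γ * n)` by 1/8 each.
  refine ⟨T, γ / (8 * e), by positivity, max ⌈2 * (ℓ * K) / δ ^ ℓ⌉₊ ⌈8 * e / γ⌉₊, ?_⟩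
  intro R V _ _ hn₀ G hY
  have hn : (0 : ℝ) < Fintype.card V := by exact_mod_cast Fintype.card_pos
  have hn₁ : 2 * (ℓ * K) / δ ^ ℓ ≤ Fintype.card V :=
    (Nat.le_ceil _).trans (by exact_mod_cast (le_max_left _ _).trans hn₀)
  have hn₂ : 8 * e / γ ≤ Fintype.card V :=
    (Nat.le_ceil _).trans (by exact_mod_cast (le_max_right _ _).trans hn₀)
  have hδℓ : 0 < δ ^ ℓ := by positivity
  have hTle : 8 * (K + 1) / δ ^ ℓ ≤ T := Nat.le_ceil _
  have hg := mul_iterate_ind_smallVerts_le (V := V) R hδ.le (p := δ ^ ℓ / 2) (by positivity)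
    (by
      rw [div_le_iff₀ hδℓ] at hn₁
      have : ℓ * K / (Fintype.card V : ℝ) ≤ δ ^ ℓ / 2 := by
        rw [div_le_iff₀ hn]
        linarith
      linarith) (T * Fintype.card V) G
  have hf := iterate_invCard_le (p := IsPersistent R) (fun m hm => hm.le) R (T * Fintype.card V) G
  have hpot : (smallPotential K G : ℝ) ≤ (K + 1) * Fintype.card V := by
    exact_mod_cast smallPotential_le K G
  set t := T * Fintype.card V with ht
  have htn : (t : ℝ) = T * Fintype.card V := by rw [ht]; push_cast; ring
  set n : ℝ := (Fintype.card V : ℝ)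
  set x := (transition R)^[t] (fun G => ind (δ * n < #(smallVerts K G))) G with hx
  have hx0 : x ≤ 1 / 4 := by
    rw [htn] at hg
    rw [div_le_iff₀ hδℓ] at hTle
    have h1 : 4 * (K + 1) * n * x ≤ (K + 1) * n := by
      by_cases hx1 : 0 ≤ x
      · calc 4 * (K + 1) * n * x = 8 * (K + 1) * (n * x / 2) := by ring
          _ ≤ T * δ ^ ℓ * (n * x / 2) := by gcongr
          _ = T * n * (δ ^ ℓ / 2) * x := by ring
          _ ≤ _ := hg.trans hpot
      · have : 4 * (K + 1) * n * x ≤ 0 :=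
          mul_nonpos_of_nonneg_of_nonpos (by positivity) (not_le.1 hx1).le
        exact this.trans (by positivity)
    have h2 : 0 < (K + 1) * n := by positivity
    by_contra hlt
    nlinarith
  have hf2 : (transition R)^[t] (invCard (IsPersistent R)) G ≤ e * (1 / (γ * n)) := by
    refine hf.trans ?_
    have h1 : (1 + C / n) ^ t ≤ e := by
      calc (1 + C / n) ^ t ≤ (Real.exp (C / n)) ^ t := by
            gcongr
            linarith [Real.add_one_le_exp (C / n)]
        _ = e := by
            rw [← Real.exp_nat_mul, htn, he]
            congr 1
            field_simp
    have h2 : invCard (IsPersistent R) G ≤ 1 / (γ * n) := by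
      unfold invCard
      gcongr
      linarith
    exact mul_le_mul h1 h2 (invCard_pos _ _).le he0.le
  set γ' := γ / (8 * e) with hγ'
  have hγ'0 : 0 < γ' := by positivity
  -- Pointwise union bound: there are too many small vertices, or too few persistent ones, or the
  -- desired event holds.
  have h3 := iterate_transition_mono R (f := fun _ => (1 : ℝ))
    (g := fun G => (ind (δ * n < #(smallVerts K G)) +
      (γ' * n + 1) * invCard (IsPersistent R) G) +
        ind ((#(smallVerts K G) : ℝ) ≤ δ * n ∧ γ' * n ≤ #(persistentVerts R G)))
      (fun G => by
        have hi := invCard_pos (IsPersistent R) G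
        have hi2 : 0 < (γ' * n + 1) * invCard (IsPersistent R) G := by positivity
        by_cases h1 : δ * n < #(smallVerts K G)
        · rw [ind_of h1]
          linarith [ind_nonneg ((#(smallVerts K G) : ℝ) ≤ δ * n ∧
            γ' * n ≤ #(persistentVerts R G))]
        · by_cases h2 : γ' * n ≤ #(persistentVerts R G)
          · rw [ind_of_not h1, ind_of ⟨not_lt.1 h1, h2⟩]
            linarith
          · have h3 : 1 ≤ (γ' * n + 1) * invCard (IsPersistent R) G := by
              rw [invCard, mul_one_div, one_le_div (by positivity)]
              linarith
            linarith [ind_nonneg ((#(smallVerts K G) : ℝ) ≤ δ * n ∧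
              γ' * n ≤ #(persistentVerts R G)), ind_nonneg (δ * n < #(smallVerts K G))]) t G
  rw [iterate_transition_const, iterate_transition_add, iterate_transition_add,
    iterate_transition_const_mul] at h3
  simp only [] at h3
  have h4 : (γ' * n + 1) * (transition R)^[t] (invCard (IsPersistent R)) G ≤ 1 / 4 := by
    calc _ ≤ (γ' * n + 1) * (e * (1 / (γ * n))) := by gcongr
      _ = 1 / 8 + (e / γ) / n := by
        rw [hγ']
        field_simp
      _ ≤ 1 / 8 + 1 / 8 := by
        refine add_le_add_right ?_ _
        rw [div_le_iff₀ hn]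
        linarith [mul_div_assoc 8 e γ]
      _ = 1 / 4 := by norm_num
  linarith

end Decline

/-! ### The creation of small components -/

section Creation

variable {K ℓ : ℕ} {V : Type*} [Fintype V]

/-- All offered edges join an isolated vertex and a vertex of a component of size `j`. -/
def IsCreating (G : SimpleGraph V) (j : ℕ) (v : Fin ℓ → V) : Prop :=
  ∀ i : Fin (ℓ / 2), compSize G (v (fstPos i)) = 1 ∧ compSize G (v (sndPos i)) = j ∧
    ¬ G.Reachable (v (sndPos i)) (v (fstPos i))

theorem card_sizeFilter_lt_of_isCreating {R : Rule K ℓ} {G : SimpleGraph V} {j : ℕ} (hj : 1 ≤ j)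
    {v : Fin ℓ → V} (h : IsCreating G j v) :
    #(sizeFilter (· = j + 1) G) < #(sizeFilter (· = j + 1) (step R G v)) := by
  obtain ⟨h1, h2, h3⟩ := h (chosen R G v)
  refine card_lt_card ((ssubset_iff_of_subset ?_).2 ⟨v (fstPos (chosen R G v)), ?_, ?_⟩)
  · rw [step_eq]
    -- Since `j ≥ 1`, neither endpoint lies in a component of size `j + 1`, so none of these is
    -- destroyed.
    exact sizeFilter_subset_sup_edge (by omega) (by omega)
  · rw [mem_sizeFilter, step_eq, compSize_sup_edge (fun h => h3 h.symm) (Or.inl .rfl), h1, h2,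
      add_comm]
  · rw [mem_sizeFilter]
    omega

theorem le_prob_isCreating [Nonempty V] (hK : 1 ≤ K) (G : SimpleGraph V) (j : ℕ) :
    ((#(sizeFilter (· = 1) G) : ℝ) / Fintype.card V *
      (#(sizeFilter (· = j) G) / Fintype.card V)) ^ ℓ - ℓ * K / Fintype.card V ≤
    prob (fun v : Fin ℓ → V => IsCreating G j v) := by
  have hn : (0 : ℝ) < Fintype.card V := by exact_mod_cast Fintype.card_pos
  set A := sizeFilter (· = 1) G with hA
  set B := sizeFilter (· = j) G with hB
  have hfrac : ∀ S : Finset V, (#S : ℝ) / Fintype.card V ≤ 1 := fun S => by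
    rw [div_le_one hn]
    exact_mod_cast card_le_univ S
  have h1 := prob_forall_mem (fun k : Fin ℓ => if Even k.1 then A else B)
  -- Every factor is bounded below by the product of both proportions, which avoids counting even
  -- and odd positions.
  have h2 : ((#A : ℝ) / Fintype.card V * (#B / Fintype.card V)) ^ ℓ ≤
      ∏ k : Fin ℓ, ((#(if Even k.1 then A else B) : ℝ) / Fintype.card V) := by
    refine le_trans (le_of_eq ?_) (prod_le_prod (s := univ)
      (f := fun _ : Fin ℓ => (#A : ℝ) / Fintype.card V * (#B / Fintype.card V))
      (fun _ _ => by positivity) fun k _ => ?_)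
    · rw [prod_const, card_univ, Fintype.card_fin]
    · split_ifs
      · exact mul_le_of_le_one_right (by positivity) (hfrac B)
      · exact mul_le_of_le_one_left (by positivity) (hfrac A)
  have h3 := prob_le_add
    (P := fun v : Fin ℓ → V => ∀ k : Fin ℓ, v k ∈ if Even k.1 then A else B)
    (Q := fun v : Fin ℓ → V => IsCreating G j v)
    (S := fun v : Fin ℓ → V => ∃ i : Fin (ℓ / 2), compSize G (v (fstPos i)) ≤ K ∧
      G.Reachable (v (sndPos i)) (v (fstPos i))) (fun v hv => by
      have hf : ∀ i : Fin (ℓ / 2), compSize G (v (fstPos i)) = 1 := fun i => by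
        have := hv (fstPos i)
        rw [if_pos (by simp [fstPos])] at this
        exact mem_sizeFilter.1 this
      have hs : ∀ i : Fin (ℓ / 2), compSize G (v (sndPos i)) = j := fun i => by
        have := hv (sndPos i)
        rw [if_neg (by simp [sndPos])] at this
        exact mem_sizeFilter.1 this
      by_cases h : ∀ i : Fin (ℓ / 2), ¬ G.Reachable (v (sndPos i)) (v (fstPos i))
      · exact Or.inl fun i => ⟨hf i, hs i, h i⟩
      · push Not at h
        obtain ⟨i, hi⟩ := h
        exact Or.inr ⟨i, (hf i).trans_le hK, hi⟩)
  have h4 := prob_reachable_le K ℓ G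
  linarith

theorem le_transition_card_sizeFilter [Nonempty V] (hK : 1 ≤ K) (R : Rule K ℓ)
    (G : SimpleGraph V) {j : ℕ} (hj : 1 ≤ j) (hjK : j + 1 ≤ K) :
    (1 - 2 * K * ℓ / Fintype.card V) * #(sizeFilter (· = j + 1) G) +
      (((#(sizeFilter (· = 1) G) : ℝ) / Fintype.card V *
        (#(sizeFilter (· = j) G) / Fintype.card V)) ^ ℓ - ℓ * K / Fintype.card V) ≤
    transition R (fun G => (#(sizeFilter (· = j + 1) G) : ℝ)) G := by
  have h1 : ∀ v : Fin ℓ → V, (#(sizeFilter (· = j + 1) G) : ℝ) -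
      2 * K * ind (∃ i, v i ∈ sizeFilter (· = j + 1) G) + ind (IsCreating G j v) ≤
      #(sizeFilter (· = j + 1) (step R G v)) := by
    intro v
    have hnn := ind_nonneg (∃ i, v i ∈ sizeFilter (· = j + 1) G)
    by_cases hc : IsCreating G j v
    · have : (#(sizeFilter (· = j + 1) G) : ℝ) + 1 ≤ #(sizeFilter (· = j + 1) (step R G v)) := by
        exact_mod_cast card_sizeFilter_lt_of_isCreating hj hc
      rw [ind_of hc]
      have : 0 ≤ 2 * K * ind (∃ i, v i ∈ sizeFilter (· = j + 1) G) := by positivity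
      linarith
    · rw [ind_of_not hc, add_zero]
      by_cases hlt : #(sizeFilter (· = j + 1) (step R G v)) < #(sizeFilter (· = j + 1) G)
      · have hex : ∃ i, v i ∈ sizeFilter (· = j + 1) G := by
          rcases exists_mem_sizeFilter_of_step_lt hlt with h | h
          · exact ⟨_, h⟩
          · exact ⟨_, h⟩
        have := card_sizeFilter_le_sup_edge (p := (· = j + 1)) (fun m hm => hm.trans_le hjK) G
          (v (fstPos (chosen R G v))) (v (sndPos (chosen R G v)))
        rw [← step_eq] at this
        rw [ind_of hex, mul_one, sub_le_iff_le_add]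
        exact_mod_cast this
      · have : (#(sizeFilter (· = j + 1) G) : ℝ) ≤ #(sizeFilter (· = j + 1) (step R G v)) := by
          exact_mod_cast not_lt.1 hlt
        have : 0 ≤ 2 * K * ind (∃ i, v i ∈ sizeFilter (· = j + 1) G) := by positivity
        linarith
  have h2 : (#(sizeFilter (· = j + 1) G) : ℝ) -
      2 * K * prob (fun v : Fin ℓ → V => ∃ i, v i ∈ sizeFilter (· = j + 1) G) +
      prob (fun v : Fin ℓ → V => IsCreating G j v) ≤
      transition R (fun G => (#(sizeFilter (· = j + 1) G) : ℝ)) G := by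
    refine le_trans (le_of_eq ?_) (expect_le_expect fun v _ => h1 v)
    rw [expect_add_distrib, expect_sub_distrib, Fintype.expect_const, ← mul_expect, prob, prob]
  have h3 := le_prob_isCreating (ℓ := ℓ) hK G j
  have h4 := prob_exists_mem_le (ι := Fin ℓ) (sizeFilter (· = j + 1) G)
  rw [Fintype.card_fin] at h4
  have h5 := mul_le_mul_of_nonneg_left h4 (by positivity : (0 : ℝ) ≤ 2 * K)
  have h6 : (1 - 2 * K * ℓ / (Fintype.card V : ℝ)) * #(sizeFilter (· = j + 1) G) =
    #(sizeFilter (· = j + 1) G) -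
      2 * K * (ℓ * (#(sizeFilter (· = j + 1) G) / Fintype.card V)) := by ring
  linarith

theorem le_add_two_mul_card_isolated (R : Rule K ℓ) (m : ℕ) (t : ℕ) (G : SimpleGraph V)
    (v : Fin ℓ → V) (h : m ≤ #(sizeFilter (· = 1) G) + 2 * t) :
    m ≤ #(sizeFilter (· = 1) (step R G v)) + 2 * (t + 1) := by
  have := card_sizeFilter_le_sup_edge (K := 1) (p := (· = 1)) (fun m hm => hm.le) G
    (v (fstPos (chosen R G v))) (v (sndPos (chosen R G v)))
  rw [← step_eq] at this
  omega

theorem card_isolated_bot : #(sizeFilter (· = 1) (⊥ : SimpleGraph V)) = Fintype.card V := by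
  rw [← card_univ]
  congr 1
  ext v
  simp [compSize_eq_ncard]

/-- Comparison of expectations along the process when at least half of the vertices are known to be
isolated. -/
theorem iterate_transition_bot_mono (R : Rule K ℓ) {f g : SimpleGraph V → ℝ} {t : ℕ}
    (ht : 4 * t ≤ Fintype.card V)
    (h : ∀ G, Fintype.card V ≤ 2 * #(sizeFilter (· = 1) G) → f G ≤ g G) :
    (transition R)^[t] f ⊥ ≤ (transition R)^[t] g ⊥ :=
  iterate_transition_mono_of_invariant
    (I := fun t G => Fintype.card V ≤ #(sizeFilter (· = 1) G) + 2 * t) R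
    (fun t G v hG => le_add_two_mul_card_isolated R _ t G v hG) t 0 ⊥
    (by rw [card_isolated_bot]; omega) fun G hG => h G (by omega)

/-- A linear minorant of the power; it takes the role of Jensen's inequality when only the
expectation of `b` is known. -/
theorem tangent_le_pow {a b : ℝ} (ha : 0 ≤ a) (hb : 0 ≤ b) (hℓ : 1 ≤ ℓ) :
    a ^ (ℓ - 1) * (b - a) ≤ b ^ ℓ := by
  rcases le_total a b with h | h
  · calc a ^ (ℓ - 1) * (b - a) ≤ b ^ (ℓ - 1) * b := by
          gcongr
          linarith
      _ = b ^ ℓ := by rw [← pow_succ, Nat.sub_add_cancel hℓ]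
  · exact (mul_nonpos_of_nonneg_of_nonpos (by positivity) (by linarith)).trans (by positivity)

/-- Below the level `p / (2 * c)` the loss takes at most half of `p`, so every step gains `p / 2`;
from above that level a step cannot fall below it. -/
theorem min_le_of_recurrence {e : ℕ → ℝ} {c p : ℝ} (hc0 : 0 < c) (hc1 : c ≤ 1) (hp : 0 ≤ p)
    {s : ℕ} (hs : 0 ≤ e s) (m : ℕ) (h : ∀ i < m, (1 - c) * e (s + i) + p ≤ e (s + i + 1)) :
    min (m * (p / 2)) (p / (2 * c)) ≤ e (s + m) := by
  induction m with
  | zero => exact (min_le_left _ _).trans (by simpa using hs)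
  | succ m ih =>
    have h1 := ih fun i hi => h i (by omega)
    have h2 := h m (by omega)
    rw [← add_assoc s m 1]
    refine le_trans ?_ h2
    have h3 : p / (2 * c) * c = p / 2 := by field_simp
    rcases le_total (e (s + m)) (p / (2 * c)) with h4 | h4
    · have h5 : c * e (s + m) ≤ p / 2 := by
        rw [← h3, mul_comm]
        gcongr
      have h6 : e (s + m) + p / 2 ≤ (1 - c) * e (s + m) + p := by linarith
      refine le_trans ?_ h6
      rcases min_le_iff.1 h1 with h7 | h7
      · refine (min_le_left _ _).trans ?_
        push_cast
        linarith
      · refine (min_le_right _ _).trans ?_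
        linarith
    · refine (min_le_right _ _).trans ?_
      have h5 : (1 - c) * (p / (2 * c)) ≤ (1 - c) * e (s + m) :=
        mul_le_mul_of_nonneg_left h4 (by linarith)
      have h6 : (1 - c) * (p / (2 * c)) = p / (2 * c) - p / 2 := by rw [← h3]; ring
      linarith

/-- For every `j ≤ K`, linearly many vertices are expected to lie in components of size `j` from
round `(j - 1) n / (4 K)` to round `n / 4`. -/
theorem exists_le_expected_card (hK : 1 ≤ K) (hℓ : 1 ≤ ℓ) (j : ℕ) (hj : 1 ≤ j) (hjK : j ≤ K) :
    ∃ α : ℝ, 0 < α ∧ ∃ n₀ : ℕ, ∀ (R : Rule K ℓ) (V : Type) [Fintype V] [Nonempty V],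
      n₀ ≤ Fintype.card V → ∀ t : ℕ, (j - 1) * Fintype.card V ≤ 4 * K * t →
        4 * t ≤ Fintype.card V →
        α * Fintype.card V ≤
          (transition R)^[t] (fun G : SimpleGraph V => (#(sizeFilter (· = j) G) : ℝ)) ⊥ := by
  induction j, hj using Nat.le_induction with
  | base =>
    refine ⟨1 / 2, by norm_num, 0, fun R V _ _ _ t _ ht => ?_⟩
    have h := iterate_transition_bot_mono R (f := fun _ => 1 / 2 * (Fintype.card V : ℝ))
      (g := fun G => (#(sizeFilter (· = 1) G) : ℝ)) ht (fun G hG => by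
        have : (Fintype.card V : ℝ) ≤ 2 * #(sizeFilter (· = 1) G) := by exact_mod_cast hG
        linarith)
    rwa [iterate_transition_const] at h
  | succ j hj ih =>
    obtain ⟨α, hα, n₀, h⟩ := ih (by omega)
    have hK' : (1 : ℝ) ≤ K := by exact_mod_cast hK
    have hℓ' : (1 : ℝ) ≤ ℓ := by exact_mod_cast hℓ
    set q : ℝ := (1 / 2) ^ ℓ * (α / 2) ^ (ℓ - 1) with hq
    have hq0 : 0 < q := by positivity
    -- The linear minorant at `α / 2` yields `q * α / 2 = 2 * p`; the other half covers the error `ℓ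
    -- * K / n`.
    set p : ℝ := q * α / 4 with hp
    have hp0 : 0 < p := by positivity
    set C : ℝ := 2 * K * ℓ with hC
    have hC0 : 0 < C := by positivity
    refine ⟨min (p / (16 * K)) (p / (2 * C)), by positivity,
      max (max n₀ (8 * K)) (max ⌈C⌉₊ ⌈ℓ * K / p⌉₊), fun R V _ _ hn₀ t ht1 ht2 => ?_⟩
    have hn : (0 : ℝ) < Fintype.card V := by exact_mod_cast Fintype.card_pos
    simp only [max_le_iff] at hn₀
    obtain ⟨⟨hna, hnb⟩, hnc, hnd⟩ := hn₀
    have hn2 : (8 * K : ℝ) ≤ Fintype.card V := by exact_mod_cast hnb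
    have hn3 : C ≤ Fintype.card V := (Nat.le_ceil _).trans (by exact_mod_cast hnc)
    have hn4 : ℓ * K / p ≤ Fintype.card V := (Nat.le_ceil _).trans (by exact_mod_cast hnd)
    -- The last `m` rounds before `t` suffice: throughout them the induction hypothesis already
    -- supplies components of size `j`.
    set m : ℕ := Fintype.card V / (4 * K) with hm
    have hm1 : 4 * K * m ≤ Fintype.card V := Nat.mul_div_le _ _
    have hm2 : Fintype.card V < 4 * K * (m + 1) :=
      Nat.lt_mul_div_succ _ (by omega)
    rw [Nat.add_sub_cancel] at ht1
    have hmt : m ≤ t := by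
      have h1 : 1 * Fintype.card V ≤ j * Fintype.card V := Nat.mul_le_mul_right _ hj
      by_contra hlt
      have h2 : 4 * K * (t + 1) ≤ 4 * K * m := Nat.mul_le_mul_left _ (by omega)
      rw [mul_add] at h2
      omega
    have hs1 : (j - 1) * Fintype.card V ≤ 4 * K * (t - m) := by
      rw [Nat.sub_mul, Nat.mul_sub]
      omega
    set e : ℕ → ℝ := fun t => (transition R)^[t]
      (fun G => (#(sizeFilter (· = j + 1) G) : ℝ)) (⊥ : SimpleGraph V) with he
    have hm3 : (Fintype.card V : ℝ) < 4 * K * (m + 1) := by exact_mod_cast hm2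
    have hrec : ∀ i < m, (1 - C / Fintype.card V) * e (t - m + i) + p ≤ e (t - m + i + 1) := by
      intro i hi
      have hexp := h R V hna (t - m + i)
        (hs1.trans (Nat.mul_le_mul_left _ (Nat.le_add_right _ _))) (by omega)
      set s := t - m + i with hs
      set n : ℝ := (Fintype.card V : ℝ) with hndef
      have hbound := iterate_transition_bot_mono R (t := s)
        (f := fun G : SimpleGraph V => ((1 - C / n) * #(sizeFilter (· = j + 1) G) +
          q / n * #(sizeFilter (· = j) G)) + (-(q * (α / 2)) - ℓ * K / n))
        (g := transition R fun G => (#(sizeFilter (· = j + 1) G) : ℝ)) (by omega)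
        (fun G hG => by
          refine le_trans ?_ (le_transition_card_sizeFilter hK R G hj hjK)
          have hiso : (1 / 2 : ℝ) ≤ #(sizeFilter (· = 1) G) / n := by
            rw [le_div_iff₀ hn]
            have : n ≤ 2 * #(sizeFilter (· = 1) G) := by rw [hndef]; exact_mod_cast hG
            linarith
          have h1 := tangent_le_pow (ℓ := ℓ) (a := α / 2) (b := #(sizeFilter (· = j) G) / n)
            (by positivity) (by positivity) hℓ
          have h2 : q * (#(sizeFilter (· = j) G) / n - α / 2) ≤
              (#(sizeFilter (· = 1) G) / n * (#(sizeFilter (· = j) G) / n)) ^ ℓ := by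
            rw [mul_pow, hq, mul_assoc]
            exact (mul_le_mul_of_nonneg_left h1 (by positivity)).trans
              (mul_le_mul_of_nonneg_right (pow_le_pow_left₀ (by norm_num) hiso _) (by positivity))
          have h3 : q * (#(sizeFilter (· = j) G) / n - α / 2) =
            q / n * #(sizeFilter (· = j) G) - q * (α / 2) := by ring
          linarith)
      rw [iterate_transition_add, iterate_transition_add, iterate_transition_const_mul,
        iterate_transition_const_mul, iterate_transition_const, ← Function.iterate_succ_apply]
        at hbound
      have h4 : q * α ≤ q / n *
          (transition R)^[s] (fun G : SimpleGraph V => (#(sizeFilter (· = j) G) : ℝ)) ⊥ := by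
        calc q * α = q / n * (α * n) := by field_simp
          _ ≤ _ := by gcongr
      have h5 : ℓ * K / n ≤ p := by
        rw [div_le_iff₀ hp0] at hn4
        rw [div_le_iff₀ hn]
        linarith
      have h6 : p = q * α / 4 := hp
      simp only [he]
      linarith
    have hfin := min_le_of_recurrence (e := e) (c := C / Fintype.card V) (p := p) (by positivity)
      (by rwa [div_le_one hn]) hp0.le (s := t - m) (by
        have := iterate_transition_mono R (V := V) (f := fun _ => 0)
          (g := fun G => (#(sizeFilter (· = j + 1) G) : ℝ)) (fun G => by positivity) (t - m) ⊥
        rwa [iterate_transition_const] at this) m hrec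
    rw [Nat.sub_add_cancel hmt] at hfin
    refine le_trans (le_min ?_ ?_) hfin
    · have hm4 : (Fintype.card V : ℝ) / (8 * K) ≤ m := by
        rw [div_le_iff₀ (by positivity)]
        linarith
      calc _ ≤ p / (16 * K) * Fintype.card V := by gcongr; exact min_le_left _ _
        _ = Fintype.card V / (8 * K) * (p / 2) := by field_simp; norm_num
        _ ≤ _ := by gcongr
    · calc _ ≤ p / (2 * C) * Fintype.card V := by gcongr; exact min_le_right _ _
        _ = _ := by field_simp

/-- Reverse Markov inequality: the number of vertices in components of a persistent size `k` is at
most `n` and has expectation at least `α n`, so it reaches `α n / 2` with probability at least `α /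
2`. -/
theorem exists_le_prob_persistent (hK : 1 ≤ K) (hℓ : 1 ≤ ℓ) (R : Rule K ℓ)
    (hR : IsDegenerate R) :
    ∃ γ : ℝ, 0 < γ ∧ ∃ n₀ : ℕ, ∀ (V : Type) [Fintype V] [Nonempty V],
      n₀ ≤ Fintype.card V → γ ≤ (transition R)^[Fintype.card V / 4]
        (fun G : SimpleGraph V => ind (γ * Fintype.card V ≤ #(persistentVerts R G))) ⊥ := by
  have : Nonempty (Set.Icc 1 K) := ⟨⟨1, le_rfl, hK⟩⟩
  obtain ⟨k, hk⟩ : ∃ k, ext R k = 0 := by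
    have h := Nat.sInf_mem (Set.range_nonempty (ext R))
    have h0 : sInf (Set.range (ext R)) = 0 := hR
    rw [h0] at h
    exact h
  obtain ⟨α, hα, n₀, h⟩ := exists_le_expected_card hK hℓ k.1 k.2.1 k.2.2
  refine ⟨α / 2, by positivity, max n₀ (4 * K), fun V _ _ hn₀ => ?_⟩
  rw [max_le_iff] at hn₀
  have hn : (0 : ℝ) < Fintype.card V := by exact_mod_cast Fintype.card_pos
  have h1 := h R V hn₀.1 (Fintype.card V / 4) (by
    have h2 : (k.1 - 1) * Fintype.card V ≤ (K - 1) * Fintype.card V :=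
      Nat.mul_le_mul_right _ (Nat.sub_le_sub_right k.2.2 _)
    have h3 : Fintype.card V ≤ 4 * (Fintype.card V / 4) + 3 := by omega
    have h4 : K * Fintype.card V ≤ K * (4 * (Fintype.card V / 4) + 3) :=
      Nat.mul_le_mul_left _ h3
    rw [Nat.sub_mul K] at h2
    have h5 : 4 * K * (Fintype.card V / 4) = K * (4 * (Fintype.card V / 4)) := by ring
    rw [mul_add] at h4
    omega) (Nat.mul_div_le _ _)
  set n : ℝ := (Fintype.card V : ℝ) with hndef
  have h2 := iterate_transition_mono R (V := V)
    (f := fun G => (#(sizeFilter (· = k.1) G) : ℝ))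
    (g := fun G => n * ind (α / 2 * n ≤ #(persistentVerts R G)) + α / 2 * n) (fun G => by
      have hsub : (#(sizeFilter (· = k.1) G) : ℝ) ≤ #(persistentVerts R G) := by
        refine Nat.cast_le.2 (card_le_card fun v hv => ?_)
        rw [mem_sizeFilter] at hv ⊢
        rw [hv]
        exact ⟨k.2, hk⟩
      have hle : (#(sizeFilter (· = k.1) G) : ℝ) ≤ n := by
        rw [hndef]
        exact_mod_cast card_le_univ _
      have hpos : 0 < α / 2 * n := by positivity
      by_cases hc : α / 2 * n ≤ #(persistentVerts R G)
      · rw [ind_of hc]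
        linarith
      · rw [ind_of_not hc]
        linarith) (Fintype.card V / 4) ⊥
  rw [iterate_transition_add, iterate_transition_const_mul, iterate_transition_const] at h2
  have h3 := h1.trans h2
  by_contra hlt
  nlinarith

end Creation

/-! ### The law of the process -/

section Law

variable {K ℓ n : ℕ}

/-- The law of the draws of a single round. -/
def roundLaw (ℓ n : ℕ) [NeZero n] : Measure (Fin ℓ → Fin n) :=
  Measure.pi fun _ : Fin ℓ => (PMF.uniformOfFintype (Fin n)).toMeasure

instance [NeZero n] : IsProbabilityMeasure (roundLaw ℓ n) := by
  unfold roundLaw; infer_instance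

theorem drawLaw_eq [NeZero n] : drawLaw ℓ n = Measure.infinitePi fun _ : ℕ => roundLaw ℓ n := rfl

instance [NeZero n] : IsProbabilityMeasure (drawLaw ℓ n) := by
  rw [drawLaw_eq]; infer_instance

theorem integral_roundLaw [NeZero n] (φ : (Fin ℓ → Fin n) → ℝ) :
    ∫ v, φ v ∂(roundLaw ℓ n) = 𝔼 v, φ v := by
  rw [integral_fintype Integrable.of_finite, Fintype.expect_eq_sum_div_card, sum_div]
  refine sum_congr rfl fun v _ => ?_
  rw [Measure.real, roundLaw, Measure.pi_singleton]
  simp [div_eq_inv_mul]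

instance measurableSpaceSimpleGraph : MeasurableSpace (SimpleGraph (Fin n)) := ⊤

instance : DiscreteMeasurableSpace (SimpleGraph (Fin n)) := ⟨fun _ => trivial⟩

theorem measurable_graphProcess (R : Rule K ℓ) (N : ℕ) :
    Measurable fun x : ℕ → Fin ℓ → Fin n => graphProcess R x N := by
  induction N with
  | zero => exact measurable_const
  | succ N ih =>
    have h : Measurable fun p : SimpleGraph (Fin n) × (Fin ℓ → Fin n) => step R p.1 p.2 :=
      Measurable.of_discrete
    exact h.comp (ih.prodMk (measurable_pi_apply N))

theorem graphProcess_congr (R : Rule K ℓ) {N : ℕ} {x y : ℕ → Fin ℓ → Fin n}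
    (h : ∀ i < N, x i = y i) : graphProcess R x N = graphProcess R y N := by
  induction N with
  | zero => rfl
  | succ N ih =>
    rw [graphProcess, graphProcess, ih fun i hi => h i (by omega), h N (by omega)]

/-- The graph `G_N` is a function of the draws with index below `N`. -/
theorem indepFun_graphProcess [NeZero n] (R : Rule K ℓ) (N : ℕ) :
    IndepFun (fun x => graphProcess R x N) (fun x => x N) (drawLaw ℓ n) := by
  have h0 : iIndepFun (fun (i : ℕ) (x : ℕ → Fin ℓ → Fin n) => x i) (drawLaw ℓ n) := by
    rw [drawLaw_eq]
    exact iIndepFun_infinitePi (X := fun _ v => v) fun _ => measurable_id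
  have h1 := h0.indepFun_finset (Finset.range N) {N} (by simp)
    (fun i => measurable_pi_apply i)
  -- The default value 0 is never read by the first `N` rounds.
  let extend : ((i : Finset.range N) → Fin ℓ → Fin n) → ℕ → Fin ℓ → Fin n :=
    fun y i => if h : i ∈ Finset.range N then y ⟨i, h⟩ else 0
  have hext : Measurable extend := by
    refine measurable_pi_lambda _ fun i => ?_
    by_cases h : i ∈ Finset.range N
    · simpa only [extend, h, dif_pos] using measurable_pi_apply _
    · simpa only [extend, h, dif_neg, not_false_eq_true] using measurable_const
  have h2 := h1.comp ((measurable_graphProcess R N).comp hext)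
    (measurable_pi_apply (⟨N, mem_singleton_self N⟩ : ({N} : Finset ℕ)))
  refine h2.congr (Filter.Eventually.of_forall fun x => ?_)
    (Filter.Eventually.of_forall fun x => rfl)
  refine graphProcess_congr R fun i hi => ?_
  simp [extend, hi]

/-- The expectation of a function of `G_N` is given by the iterated transition operator. -/
theorem integral_graphProcess [NeZero n] (R : Rule K ℓ) (N : ℕ) : ∀ f : SimpleGraph (Fin n) → ℝ,
    ∫ x, f (graphProcess R x N) ∂(drawLaw ℓ n) = (transition R)^[N] f ⊥ := by
  induction N with
  | zero => intro f; simp [graphProcess]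
  | succ N ih =>
    intro f
    -- The last round is averaged first, which turns `f` at `G_{N+1}` into `transition R f` at
    -- `G_N`.
    rw [Function.iterate_succ_apply, ← ih]
    have hm : Measurable fun x : ℕ → Fin ℓ → Fin n => graphProcess R x N :=
      measurable_graphProcess R N
    have he : Measurable fun x : ℕ → Fin ℓ → Fin n => x N := measurable_pi_apply N
    have hmap := (indepFun_iff_map_prod_eq_prod_map_map hm.aemeasurable he.aemeasurable).1
      (indepFun_graphProcess (n := n) R N)
    have hN : (drawLaw ℓ n).map (fun x => x N) = roundLaw ℓ n := by
      rw [drawLaw_eq]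
      exact Measure.infinitePi_map_eval _ N
    have : IsProbabilityMeasure ((drawLaw ℓ n).map fun x => graphProcess R x N) :=
      Measure.isProbabilityMeasure_map hm.aemeasurable
    calc ∫ x, f (graphProcess R x (N + 1)) ∂(drawLaw ℓ n)
        = ∫ p, f (step R p.1 p.2)
            ∂((drawLaw ℓ n).map fun x => (graphProcess R x N, x N)) := by
          rw [integral_map (hm.prodMk he).aemeasurable
            Measurable.of_discrete.aestronglyMeasurable]
          rfl
      _ = ∫ G, transition R f G ∂((drawLaw ℓ n).map fun x => graphProcess R x N) := by
          rw [hmap, hN, integral_prod _ Integrable.of_finite]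
          refine integral_congr_ae (Filter.Eventually.of_forall fun G => ?_)
          exact integral_roundLaw fun v => f (step R G v)
      _ = _ := integral_map hm.aemeasurable Measurable.of_discrete.aestronglyMeasurable

theorem graphProcess_mono (R : Rule K ℓ) (x : ℕ → Fin ℓ → Fin n) :
    Monotone (graphProcess R x) :=
  monotone_nat_of_le_succ fun N => le_step R _ (x N)

theorem le_connTime {R : Rule K ℓ} {x : ℕ → Fin ℓ → Fin n} {M : ℕ}
    (h : ¬ (graphProcess R x M).Connected) : (M : ℕ∞) ≤ connTime R x := by
  refine le_iInf₂ fun N hN => ?_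
  by_contra hlt
  have hNM : N ≤ M := by exact_mod_cast (not_le.1 hlt).le
  exact h (hN.mono (graphProcess_mono R x hNM))

theorem not_connected_of_persistentVerts_nonempty {R : Rule K ℓ} {G : SimpleGraph (Fin n)}
    (hn : K < n) (h : (persistentVerts R G).Nonempty) : ¬ G.Connected := by
  intro hG
  obtain ⟨v, hv⟩ := h
  have h1 := (mem_sizeFilter.1 hv).le
  have h2 : compSize G v = n := by
    rw [compSize_eq_ncard]
    have : {x | G.Reachable v x} = Set.univ := Set.eq_univ_of_forall fun x => hG.preconnected v x
    rw [this, Set.ncard_univ, Nat.card_eq_fintype_card, Fintype.card_fin]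
  omega

/-- Markov's inequality: a persistent vertex at time `M` lies in a component of at most `K < n`
vertices, so the connection time is at least `M`. -/
theorem le_expectedConnTime [NeZero n] (R : Rule K ℓ) (hn : K < n) (M : ℕ) :
    ENNReal.ofReal (M * (transition R)^[M]
      (fun G : SimpleGraph (Fin n) => ind (persistentVerts R G).Nonempty) ⊥) ≤
      expectedConnTime R n := by
  have hm : Measurable fun x : ℕ → Fin ℓ → Fin n =>
      (M : ℝ) * ind (persistentVerts R (graphProcess R x M)).Nonempty :=
    (Measurable.of_discrete (f := fun G : SimpleGraph (Fin n) =>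
      (M : ℝ) * ind (persistentVerts R G).Nonempty)).comp (measurable_graphProcess R M)
  have hnn : ∀ x : ℕ → Fin ℓ → Fin n,
      0 ≤ (M : ℝ) * ind (persistentVerts R (graphProcess R x M)).Nonempty :=
    fun x => mul_nonneg (by positivity) (ind_nonneg _)
  have hint : Integrable (fun x : ℕ → Fin ℓ → Fin n =>
      (M : ℝ) * ind (persistentVerts R (graphProcess R x M)).Nonempty) (drawLaw ℓ n) := by
    refine Integrable.of_bound hm.aestronglyMeasurable M (Filter.Eventually.of_forall fun x => ?_)
    rw [Real.norm_of_nonneg (hnn x)]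
    exact mul_le_of_le_one_right (by positivity) (ind_le_one _)
  rw [← integral_graphProcess, ← integral_const_mul,
    ofReal_integral_eq_lintegral_ofReal hint (Filter.Eventually.of_forall hnn), expectedConnTime]
  refine lintegral_mono fun x => ?_
  by_cases h : (persistentVerts R (graphProcess R x M)).Nonempty
  · simp only [ind_of h, mul_one, ENNReal.ofReal_natCast]
    have := le_connTime (not_connected_of_persistentVerts_nonempty hn h)
    exact_mod_cast ENat.toENNReal_le.2 this
  · simp [ind_of_not h]

end Law

/-! ### Concatenation of creation, decline and survival -/

theorem exists_le_expectedConnTime {K ℓ : ℕ} (hK : 1 ≤ K) (hℓ : 1 ≤ ℓ) (R : Rule K ℓ)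
    (hR : IsDegenerate R) : ∃ c : ℝ, 0 < c ∧ ∃ n₀ : ℕ, ∀ (n : ℕ) [NeZero n], n₀ ≤ n →
      ENNReal.ofReal (c * (n : ℝ) ^ 2) ≤ expectedConnTime R n := by
  obtain ⟨γ, hγ, n₁, h₁⟩ := exists_le_prob_persistent hK hℓ R hR
  obtain ⟨δ, hδ, h₃⟩ := exists_survival (K := K) (ℓ := ℓ) hK hℓ
  obtain ⟨T, γ', hγ', n₂, h₂⟩ := exists_decline hδ hγ K ℓ
  -- The order of choices matters: `δ` comes from survival alone, decline turns it into `γ'`, and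
  -- only then is `c` determined.
  obtain ⟨c, hc, n₃, h₃⟩ := h₃ γ' hγ'
  refine ⟨c * γ / 8, by positivity, max (max n₁ n₂) (max n₃ (max (K + 1) ⌈2 / c⌉₊)), ?_⟩
  intro n _ hn
  simp only [max_le_iff] at hn
  obtain ⟨⟨hn₁, hn₂⟩, hn₃, hnK, hnc⟩ := hn
  have hcard : Fintype.card (Fin n) = n := Fintype.card_fin n
  have h₁ := h₁ (Fin n) (by rwa [hcard])
  have h₂ := h₂ R (Fin n) (by rwa [hcard])
  have h₃ := h₃ R (Fin n) (by rwa [hcard])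
  rw [hcard] at h₁ h₂ h₃
  set t : ℕ := ⌊c * (n : ℝ) ^ 2⌋₊ with ht
  have htle : (t : ℝ) ≤ c * (n : ℝ) ^ 2 := Nat.floor_le (by positivity)
  refine le_trans (ENNReal.ofReal_le_ofReal ?_)
    (le_expectedConnTime R (by omega) (n / 4 + (T * n + t)))
  -- By the Markov property the bounds `γ`, 1/2 and 1/2 of the three phases multiply; the last phase
  -- is the innermost iterate.
  have hprob : γ / 4 ≤ (transition R)^[n / 4 + (T * n + t)]
      (fun G : SimpleGraph (Fin n) => ind (persistentVerts R G).Nonempty) ⊥ := by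
    have hs : ∀ G : SimpleGraph (Fin n),
        1 / 2 * ind ((#(smallVerts K G) : ℝ) ≤ δ * n ∧ γ' * n ≤ #(persistentVerts R G)) ≤
        (transition R)^[t] (fun G => ind (persistentVerts R G).Nonempty) G := by
      intro G
      by_cases h : (#(smallVerts K G) : ℝ) ≤ δ * n ∧ γ' * n ≤ #(persistentVerts R G)
      · rw [ind_of h, mul_one]
        exact h₃ t G htle h.1 h.2
      · rw [ind_of_not h, mul_zero]
        have := iterate_transition_mono R (V := Fin n) (f := fun _ => (0 : ℝ))
          (g := fun G => ind (persistentVerts R G).Nonempty) (fun G => ind_nonneg _) t G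
        rwa [iterate_transition_const] at this
    have hd : ∀ G : SimpleGraph (Fin n), 1 / 4 * ind (γ * n ≤ #(persistentVerts R G)) ≤
        (transition R)^[T * n] ((transition R)^[t]
          (fun G => ind (persistentVerts R G).Nonempty)) G := by
      intro G
      have hm := iterate_transition_mono R hs (T * n) G
      rw [iterate_transition_const_mul] at hm
      refine le_trans ?_ hm
      by_cases h : γ * n ≤ #(persistentVerts R G)
      · rw [ind_of h]
        linarith [h₂ G h]
      · rw [ind_of_not h, mul_zero]
        have := iterate_transition_mono R (V := Fin n) (f := fun _ => (0 : ℝ))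
          (g := fun G => ind ((#(smallVerts K G) : ℝ) ≤ δ * n ∧ γ' * n ≤ #(persistentVerts R G)))
          (fun G => ind_nonneg _) (T * n) G
        rw [iterate_transition_const] at this
        positivity
    have hm := iterate_transition_mono R hd (n / 4) ⊥
    rw [iterate_transition_const_mul] at hm
    rw [Function.iterate_add_apply, Function.iterate_add_apply]
    linarith
  have hn1 : (1 : ℝ) ≤ n := by exact_mod_cast NeZero.one_le
  have hcn : 2 / c ≤ n := (Nat.le_ceil _).trans (by exact_mod_cast hnc)
  rw [div_le_iff₀ hc] at hcn
  have ht2 : c * (n : ℝ) ^ 2 < t + 1 := Nat.lt_floor_add_one _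
  have hM : c * (n : ℝ) ^ 2 / 2 ≤ ((n / 4 + (T * n + t) : ℕ) : ℝ) := by
    have h1 : (t : ℝ) ≤ ((n / 4 + (T * n + t) : ℕ) : ℝ) := by
      exact_mod_cast (by omega : t ≤ n / 4 + (T * n + t))
    have h2 : 2 ≤ c * (n : ℝ) ^ 2 := by nlinarith
    linarith
  calc c * γ / 8 * (n : ℝ) ^ 2 = c * (n : ℝ) ^ 2 / 2 * (γ / 4) := by ring
    _ ≤ _ := by gcongr

end AchlioptasRule

end

theorem theorem2 (K ℓ : ℕ) (hK : 1 ≤ K) (hℓ : 1 ≤ ℓ) (hℓ_even : Even ℓ)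
    (R : AchlioptasRule.Rule K ℓ) (hR : AchlioptasRule.IsDegenerate R) :
    ∃ c : ℝ, 0 < c ∧ ∃ n₀ : ℕ, ∀ (n : ℕ) [NeZero n], n₀ ≤ n →
      ENNReal.ofReal (c * (n : ℝ) ^ 2) ≤ AchlioptasRule.expectedConnTime R n :=
  AchlioptasRule.exists_le_expectedConnTime hK hℓ R hR
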